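/- Let $n\ge 0$ and $N\ge 2$ be integers, let $S=\mathbb C[x_0,\dots,x_n]$ with its standard grading, and let $f\in S$ be a nonzero homogeneous polynomial of degree $N$, with partial derivatives $f_{x_0},\dots,f_{x_n}$. Assume that the hypersurface $V: f=0$ in $\mathbb P^n=\mathbb P^n(\mathbb C)$ has only isolated singularities, i.e. that its singular locus $V_{sing}$, the set of points of $\mathbb P^n$ where $f$ and all $f_{x_j}$ vanish, is finite (possibly empty). For every $p\in V_{sing}$ let $g_p=0$ be a local analytic equation of $V$ at $p$: in some local holomorphic coordinates of $\mathbb P^n$ centred at $p$, $g_p$ is an element of the ring $\mathcal O_n$ of germs of holomorphic functions at the origin of $\mathbb C^n$ that agrees, up to a unit of $\mathcal O_n$, with the germ of $f$ (evaluated on a local holomorphic lift of these coordinates to $\mathbb C^{n+1}\setminus\{0\}$). For $g\in\mathcal O_n$ let $J_g\subset\mathcal O_n$ be the ideal generated by the first partial derivatives of $g$, let $m_n\subset\mathcal O_n$ be the maximal ideal, and put $$a(g)=\min\{a\in\mathbb N : m_n^a\subset J_g+(g)\}.$$ Let $AR(f)=\{(a_0,\dots,a_n)\in S^{n+1} : \sum_j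 a_jf_{x_j}=0\}$, let $KR(f)\subset AR(f)$ be the $S$-submodule generated by the Koszul relations $f_{x_j}e_i-f_{x_i}e_j$ (where $e_0,\dots,e_n$ is the standard basis of $S^{n+1}$), and let $ER(f)=AR(f)/KR(f)$, where $ER(f)_m$ is the space of classes of relations all of whose coefficients $a_j$ are homogeneous of degree $m$. Put $$mdr(V)=\min\{q : ER(f)_q\neq 0\}.$$ For a homogeneous polynomial $h\in S$ let $M(h)=S/(h_{x_0},\dots,h_{x_n})$ be its graded Milnor algebra. Let $f_s\in S$ be any homogeneous polynomial of degree $N$ such that the hypersurface $f_s=0$ in $\mathbb P^n$ is smooth, and put $$ct(V)=\max\{q : \dim_{\mathbb C} M(f)_k=\dim_{\mathbb C} M(f_s)_k\ \text{ for all } k\le q\}.$$ (By convention $mdr(V)=\infty$ if $ER(f)=0$, and $ct(V)=\infty$ if the dimensions agree for all $k$.) Then $$mdr(V)\ \ge\ n(N-2)-\sum_{p\in V_{sing}}a(g_p)+1$$ and $$ct(V)\ \ge\ T-\sum_{p\in V_{sing}}a(g_p)+1,\qquad T=(n+1)(N-2).$$ -/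

import Mathlib

open Filter Topology
open scoped LinearAlgebra.Projectivization

noncomputable section

namespace JacobianSyzygies

/-! ### Holomorphic germs at the origin of `ℂⁿ` and the invariant `a(g)` -/

/-- The ring `𝒪ₙ` of germs at the origin of `ℂⁿ` of holomorphic functions. -/
def HolGerm (n : ℕ) : Subring (Germ (𝓝 (0 : Fin n → ℂ)) ℂ) where
  carrier := {g | ∃ h : (Fin n → ℂ) → ℂ, AnalyticAt ℂ h 0 ∧ Germ.ofFun h = g}
  mul_mem' := by
    rintro _ _ ⟨h, hh, rfl⟩ ⟨k, hk, rfl⟩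
    exact ⟨h * k, hh.mul hk, rfl⟩
  one_mem' := ⟨1, analyticAt_const, rfl⟩
  add_mem' := by
    rintro _ _ ⟨h, hh, rfl⟩ ⟨k, hk, rfl⟩
    exact ⟨h + k, hh.add hk, rfl⟩
  zero_mem' := ⟨0, analyticAt_const, rfl⟩
  neg_mem' := by
    rintro _ ⟨h, hh, rfl⟩
    exact ⟨-h, hh.neg, rfl⟩

/-- The `i`-th partial derivative of a germ of a function at the origin of `ℂⁿ`. -/
def germPartial {n : ℕ} (i : Fin n) :
    Germ (𝓝 (0 : Fin n → ℂ)) ℂ → Germ (𝓝 (0 : Fin n → ℂ)) ℂ :=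
  Germ.map' (fun h x => fderiv ℂ h x (Pi.single i 1)) (by
    intro h k hhk
    filter_upwards [hhk.fderiv (𝕜 := ℂ)] with x hx
    rw [hx])

theorem germPartial_mem {n : ℕ} (i : Fin n) (g : HolGerm n) :
    germPartial i (g : Germ (𝓝 (0 : Fin n → ℂ)) ℂ) ∈ HolGerm n := by
  obtain ⟨g, hg⟩ := g
  obtain ⟨h, hh, rfl⟩ := hg
  refine ⟨fun x => fderiv ℂ h x (Pi.single i 1), ?_, rfl⟩
  exact ((ContinuousLinearMap.apply ℂ ℂ (Pi.single i (1 : ℂ) : Fin n → ℂ)).analyticAt _).comp hh.fderiv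

/-- The `i`-th partial derivative `∂g/∂yᵢ` of a holomorphic germ. -/
def HolGerm.partialDeriv {n : ℕ} (i : Fin n) (g : HolGerm n) : HolGerm n :=
  ⟨germPartial i (g : Germ (𝓝 (0 : Fin n → ℂ)) ℂ), germPartial_mem i g⟩

/-- The maximal ideal of `𝒪ₙ`: the germs vanishing at the origin. -/
def HolGerm.maxIdeal (n : ℕ) : Ideal (HolGerm n) :=
  RingHom.ker ((Germ.valueRingHom (x := (0 : Fin n → ℂ)) (E := ℂ)).comp (HolGerm n).subtype)

/-- The Jacobian ideal `J_g` of a holomorphic germ, generated by its partial derivatives. -/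
def HolGerm.jacobianIdeal {n : ℕ} (g : HolGerm n) : Ideal (HolGerm n) :=
  Ideal.span (Set.range fun i : Fin n => HolGerm.partialDeriv i g)

/-- `a(g)`: the least `a` such that the `a`-th power of the maximal ideal of `𝒪ₙ` is contained in
the Tjurina ideal `J_g + (g)`. (Such an `a` exists when `g` has an isolated singularity.) -/
def tjurinaOrder {n : ℕ} (g : HolGerm n) : ℕ :=
  sInf {a : ℕ | HolGerm.maxIdeal n ^ a ≤ HolGerm.jacobianIdeal g ⊔ Ideal.span {g}}

/-! ### The hypersurface `V : f = 0` in `ℙⁿ` -/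

/-- The singular locus of `V : f = 0` in `ℙⁿ`, for `f` homogeneous: the points where `f` and all
its partial derivatives vanish. -/
def singularLocus {n : ℕ} (f : MvPolynomial (Fin (n + 1)) ℂ) : Set (ℙ ℂ (Fin (n + 1) → ℂ)) :=
  {p | MvPolynomial.eval p.rep f = 0 ∧
    ∀ i, MvPolynomial.eval p.rep (MvPolynomial.pderiv i f) = 0}

/-- `g = 0` is a local analytic equation at `p` for `V : f = 0`. Local holomorphic coordinates of
`ℙⁿ` centred at `p` are given by a holomorphic germ `φ : (ℂⁿ, 0) → ℂⁿ⁺¹ \ {0}` such that `φ(0)`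
represents `p` and such that `y ↦ [φ(y)]` is a local biholomorphism at `0`, i.e. the vector `φ(0)`
together with the partial derivatives of `φ` at `0` form a basis of `ℂⁿ⁺¹`. In these coordinates,
`f` has to agree with `g` up to a unit of `𝒪ₙ`. -/
def IsLocalEquation {n : ℕ} (f : MvPolynomial (Fin (n + 1)) ℂ) (p : ℙ ℂ (Fin (n + 1) → ℂ))
    (g : HolGerm n) : Prop :=
  ∃ φ : (Fin n → ℂ) → (Fin (n + 1) → ℂ), AnalyticAt ℂ φ 0 ∧
    (∃ h0 : φ 0 ≠ 0, Projectivization.mk ℂ (φ 0) h0 = p) ∧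
    (Function.Injective fun cv : ℂ × (Fin n → ℂ) => cv.1 • φ 0 + fderiv ℂ φ 0 cv.2) ∧
    ∃ u : (HolGerm n)ˣ,
      ((fun y => MvPolynomial.eval (φ y) f : (Fin n → ℂ) → ℂ) : Germ (𝓝 (0 : Fin n → ℂ)) ℂ) =
        (((u : HolGerm n) * g : HolGerm n) : Germ (𝓝 (0 : Fin n → ℂ)) ℂ)

/-! ### Jacobian syzygies -/

/-- The module `AR(f)` of all relations `∑ aⱼ f_{xⱼ} = 0` between the partial derivatives. -/
def AR {n : ℕ} (f : MvPolynomial (Fin (n + 1)) ℂ) :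
    Submodule (MvPolynomial (Fin (n + 1)) ℂ) (Fin (n + 1) → MvPolynomial (Fin (n + 1)) ℂ) :=
  LinearMap.ker (Fintype.linearCombination (MvPolynomial (Fin (n + 1)) ℂ)
    fun j => MvPolynomial.pderiv j f)

/-- The module `KR(f)` of Koszul relations, spanned by the relations
`f_{xⱼ} f_{xᵢ} + (-f_{xᵢ}) f_{xⱼ} = 0`. -/
def KR {n : ℕ} (f : MvPolynomial (Fin (n + 1)) ℂ) :
    Submodule (MvPolynomial (Fin (n + 1)) ℂ) (Fin (n + 1) → MvPolynomial (Fin (n + 1)) ℂ) :=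
  Submodule.span _ (Set.range fun ij : Fin (n + 1) × Fin (n + 1) =>
    Pi.single ij.1 (MvPolynomial.pderiv ij.2 f) - Pi.single ij.2 (MvPolynomial.pderiv ij.1 f))

/-- The module `ER(f) = AR(f) / KR(f)` of essential relations. -/
abbrev ER {n : ℕ} (f : MvPolynomial (Fin (n + 1)) ℂ) : Type :=
  AR f ⧸ (KR f).submoduleOf (AR f)

/-- `AR(f)ₘ`: the relations whose coefficients `aⱼ` are homogeneous of degree `m`. -/
def ARdeg {n : ℕ} (f : MvPolynomial (Fin (n + 1)) ℂ) (m : ℕ) : Submodule ℂ (AR f) where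
  carrier := {r | ∀ j, (r : Fin (n + 1) → MvPolynomial (Fin (n + 1)) ℂ) j ∈
    MvPolynomial.homogeneousSubmodule (Fin (n + 1)) ℂ m}
  add_mem' := fun hr hs j => Submodule.add_mem _ (hr j) (hs j)
  zero_mem' := fun _ => Submodule.zero_mem _
  smul_mem' := fun c _ hr j => Submodule.smul_mem _ c (hr j)

/-- `ER(f)ₘ`: the homogeneous component of degree `m` of `ER(f)`. -/
def ERdeg {n : ℕ} (f : MvPolynomial (Fin (n + 1)) ℂ) (m : ℕ) : Submodule ℂ (ER f) :=
  (ARdeg f m).map (((KR f).submoduleOf (AR f)).mkQ.restrictScalars ℂ)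

/-- The minimal degree of a nontrivial relation, `mdr(V) = min {q : ER(f)_q ≠ 0}`
(with value `∞` if there is no such `q`). -/
def mdr {n : ℕ} (f : MvPolynomial (Fin (n + 1)) ℂ) : ℕ∞ :=
  ⨅ (q : ℕ) (_ : ERdeg f q ≠ ⊥), (q : ℕ∞)

/-! ### The Milnor algebra and the coincidence threshold -/

/-- The Jacobian ideal `J_f` of a polynomial. -/
def jacobianIdeal {n : ℕ} (f : MvPolynomial (Fin (n + 1)) ℂ) :
    Ideal (MvPolynomial (Fin (n + 1)) ℂ) :=
  Ideal.span (Set.range fun j => MvPolynomial.pderiv j f)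

/-- The Milnor (or Jacobian) algebra `M(f) = S / J_f`. -/
abbrev MilnorAlgebra {n : ℕ} (f : MvPolynomial (Fin (n + 1)) ℂ) : Type :=
  MvPolynomial (Fin (n + 1)) ℂ ⧸ jacobianIdeal f

/-- `M(f)ₖ`: the homogeneous component of degree `k` of the Milnor algebra. -/
def MilnorAlgebra.component {n : ℕ} (f : MvPolynomial (Fin (n + 1)) ℂ) (k : ℕ) :
    Submodule ℂ (MilnorAlgebra f) :=
  (MvPolynomial.homogeneousSubmodule (Fin (n + 1)) ℂ k).map
    (Ideal.Quotient.mkₐ ℂ (jacobianIdeal f)).toLinearMap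

/-- The coincidence threshold
`ct(V) = max {q : dim M(f)ₖ = dim M(fₛ)ₖ for all k ≤ q}`, computed with the comparison polynomial
`fₛ` (with value `∞` if all these dimensions agree). -/
def ct {n : ℕ} (f fs : MvPolynomial (Fin (n + 1)) ℂ) : ℕ∞ :=
  ⨆ (q : ℕ) (_ : ∀ k ≤ q, Module.finrank ℂ (MilnorAlgebra.component f k) =
    Module.finrank ℂ (MilnorAlgebra.component fs k)), (q : ℕ∞)

end JacobianSyzygies

end

noncomputable section

namespace JacobianSyzygies

open MvPolynomial

/-! ### Homogeneous ideals of a polynomial ring -/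

section Homogeneous

variable {K ι : Type*} [Field K]

/-! Choose a linear form `l` with no zero on the singular locus. Then `l` and the partial
derivatives have no common zero in projective space, so prime avoidance yields `n` combinations of
the partials that form a regular sequence together with `l` (`exists_stronglyRegular`). Let `I` be
the ideal of these `n` forms of degree `N - 1`, and complete them by one more combination `h 0` to
generators of the Jacobian ideal `J = I + (h 0)`. The socle of `S/(I + (l))` lives in degrees at
least `n(N-2)`.

Both bounds follow from one fact (`exists_adapted_generators`): if `u` has degree `q` with `q + ∑
a(g_p) ≤ n(N-2)` and `h 0 * u ∈ I`, then `u ∈ I`. To see it, suppose `u ∉ I`; then `J` kills `u`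
modulo `I`. Since `l` is regular modulo `I`, factors `l` can be divided out of `u` until `u ∉ I +
(l)`. Anything that a power of `l` carries into `J` still kills `u` modulo `I`. Such elements,
together with `l`, generate all forms of degree `∑ a(g_p)` (`exists_saturation`), so that power of
the irrelevant ideal kills `u` modulo `I + (l)`. A nonzero multiple of `u` of degree below `q + ∑
a(g_p)` is then a socle element, a contradiction (`lt_add_of_mul_mem`).

The saturation statement is local: some form not vanishing at `p` carries the `a(g_p)`-th power of
the ideal of `p` into `J`. The Nullstellensatz gives this with a crude exponent; approximating germs
by forms modulo a high power of the maximal ideal lowers the exponent to the analytic one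
(`mul_mem_jacobianIdeal_of_tjurinaOrder`).

For `mdr`, a relation of low degree has its coefficient at `h 0` in `I`, hence is Koszul
(`mem_KR_of_mem_AR`). For `ct`, regularity of `h 0` in low degrees fixes the Hilbert function there
(`finrank_component_congr`). -/

theorem homogeneousComponent_mul_of_isHomogeneous {h : MvPolynomial ι K} {d : ℕ}
    (hh : h.IsHomogeneous d) (v : MvPolynomial ι K) (k : ℕ) :
    homogeneousComponent k (h * v) =
      if d ≤ k then h * homogeneousComponent (k - d) v else 0 := by
  classical
  have key : ∀ j, homogeneousComponent k (h * homogeneousComponent j v) =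
      if k = d + j then h * homogeneousComponent j v else 0 := fun j =>
    homogeneousComponent_of_mem (hh.mul (homogeneousComponent_isHomogeneous j v))
  conv_lhs => rw [← sum_homogeneousComponent v]
  rw [Finset.mul_sum, map_sum]
  simp_rw [key]
  split_ifs with hdk
  · rw [Finset.sum_eq_single (k - d)]
    · rw [if_pos (by omega)]
    · intro j _ hj
      rw [if_neg (by omega)]
    · intro hj
      rw [if_pos (by omega), homogeneousComponent_eq_zero _ _ (by rw [Finset.mem_range] at hj; omega), mul_zero]
  · exact Finset.sum_eq_zero fun j _ => if_neg (by omega)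

/-- An ideal containing all homogeneous components of its elements. -/
def IsHomogeneousIdeal (I : Ideal (MvPolynomial ι K)) : Prop :=
  ∀ p ∈ I, ∀ k, homogeneousComponent k p ∈ I

theorem isHomogeneousIdeal_span {s : Set (MvPolynomial ι K)}
    (hs : ∀ h ∈ s, ∃ d, h.IsHomogeneous d) : IsHomogeneousIdeal (Ideal.span s) := by
  intro p hp k
  induction hp using Submodule.span_induction with
  | mem x hx =>
    classical
    obtain ⟨d, hd⟩ := hs x hx
    rw [homogeneousComponent_of_mem hd]
    split_ifs
    · exact Ideal.subset_span hx
    · exact zero_mem _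
  | zero => simp
  | add x y _ _ hx hy => rw [map_add]; exact add_mem hx hy
  | smul r x hx ih =>
    -- Knowing the components of `x` is not enough for those of `r * x`, so a second induction runs
    -- over all multipliers `r` at once.
    clear ih
    induction hx using Submodule.span_induction generalizing r with
    | mem x hx =>
      obtain ⟨d, hd⟩ := hs x hx
      rw [smul_eq_mul, mul_comm, homogeneousComponent_mul_of_isHomogeneous hd]
      split_ifs
      · exact Ideal.mul_mem_right _ _ (Ideal.subset_span hx)
      · exact zero_mem _
    | zero => simp
    | add x y _ _ hx hy => rw [smul_add, map_add]; exact add_mem (hx r) (hy r)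
    | smul t x _ ih => rw [smul_smul]; exact ih _

theorem IsHomogeneousIdeal.mem_of_components {I : Ideal (MvPolynomial ι K)}
    {p : MvPolynomial ι K} (h : ∀ k, homogeneousComponent k p ∈ I) : p ∈ I := by
  rw [← sum_homogeneousComponent p]
  exact Ideal.sum_mem _ fun k _ => h k

/-- A homogeneous element of `I + (h)` agrees modulo `I` with a homogeneous multiple of `h`. -/
theorem IsHomogeneousIdeal.exists_of_mem_sup {I : Ideal (MvPolynomial ι K)}
    (hI : IsHomogeneousIdeal I) {h p : MvPolynomial ι K} {d k : ℕ} (hh : h.IsHomogeneous d)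
    (hp : p.IsHomogeneous k) (hmem : p ∈ I ⊔ Ideal.span {h}) :
    ∃ v, v.IsHomogeneous (k - d) ∧ p - h * v ∈ I ∧ (k < d → v = 0) := by
  classical
  obtain ⟨i, hi, j, hj, rfl⟩ := Submodule.mem_sup.1 hmem
  obtain ⟨v, rfl⟩ := Ideal.mem_span_singleton'.1 hj
  have e : i + v * h = homogeneousComponent k i + if d ≤ k then h * homogeneousComponent (k - d) v
      else 0 := by
    conv_lhs => rw [← homogeneousComponent_eq_self hp]
    rw [map_add, mul_comm v h, homogeneousComponent_mul_of_isHomogeneous hh]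
  -- For `k < d` the difference `k - d` truncates to `0`, so `v` has to be set to zero explicitly.
  refine ⟨if d ≤ k then homogeneousComponent (k - d) v else 0, ?_, ?_, fun hk => if_neg (by omega)⟩
  · split_ifs
    · exact homogeneousComponent_isHomogeneous _ _
    · exact isHomogeneous_zero _ _ _
  · rw [e]
    split_ifs
    · simpa using hI i hi k
    · simpa using hI i hi k

end Homogeneous

/-! ### Strongly regular sequences -/

section Regular

variable {R ι : Type*} [CommRing R]

/-- Multiplication by `b` is injective on `R ⧸ I`. -/
def IsNzdMod (I : Ideal R) (b : R) : Prop :=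
  ∀ c, b * c ∈ I → c ∈ I

/-- A family of elements each of which is a nonzerodivisor modulo any set of other ones. -/
def StronglyRegular (a : ι → R) : Prop :=
  ∀ i, ∀ T : Set ι, i ∉ T → IsNzdMod (Ideal.span (a '' T)) (a i)

theorem span_image_insert (a : ι → R) (j : ι) (T : Set ι) :
    Ideal.span (a '' insert j T) = Ideal.span (a '' T) ⊔ Ideal.span {a j} := by
  rw [Set.image_insert_eq, Ideal.span_insert, sup_comm]

theorem IsNzdMod.pow {I : Ideal R} {b : R} (hb : IsNzdMod I b) (t : ℕ) : IsNzdMod I (b ^ t) := by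
  induction t with
  | zero => intro c hc; simpa using hc
  | succ t ih => intro c hc; rw [pow_succ, mul_assoc] at hc; exact hb _ (ih _ hc)

/-- Exchanging the order of a regular sequence of length two. -/
theorem IsNzdMod.exchange {I : Ideal R} {a b : R} (ha : IsNzdMod I a)
    (hb : IsNzdMod (I ⊔ Ideal.span {a}) b) : IsNzdMod (I ⊔ Ideal.span {b}) a := by
  intro c hc
  obtain ⟨i, hi, j, hj, hij⟩ := Submodule.mem_sup.1 hc
  obtain ⟨e, rfl⟩ := Ideal.mem_span_singleton'.1 hj
  have he : e ∈ I ⊔ Ideal.span {a} := by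
    apply hb
    have : b * e = -i + c * a := by linear_combination hij
    rw [this]
    exact Submodule.add_mem_sup (neg_mem hi) (Ideal.mem_span_singleton'.2 ⟨c, rfl⟩)
  obtain ⟨i', hi', j', hj', hij'⟩ := Submodule.mem_sup.1 he
  obtain ⟨e', rfl⟩ := Ideal.mem_span_singleton'.1 hj'
  have hc' : c - e' * b ∈ I := by
    apply ha
    have : a * (c - e' * b) = i + i' * b := by linear_combination -hij - b * hij'
    rw [this]
    exact add_mem hi (Ideal.mul_mem_right _ _ hi')
  have : c = (c - e' * b) + e' * b := by ring
  rw [this]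
  exact Submodule.add_mem_sup hc' (Ideal.mem_span_singleton'.2 ⟨e', rfl⟩)

end Regular

/-! ### Regular sequences of forms and prime avoidance -/

section RegularHomogeneous

variable {K ι : Type*} [Field K]

/-- A homogeneous element that is regular modulo `I + (a)`, where `a` is homogeneous of positive
degree and regular modulo the homogeneous ideal `I`, is regular modulo `I`. -/
theorem IsNzdMod.descend {I : Ideal (MvPolynomial ι K)} (hI : IsHomogeneousIdeal I)
    {a b : MvPolynomial ι K} {e d : ℕ} (he : 0 < e) (ha : a.IsHomogeneous e)
    (hb : b.IsHomogeneous d) (hna : IsNzdMod I a) (hnb : IsNzdMod (I ⊔ Ideal.span {a}) b) :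
    IsNzdMod I b := by
  have hom : ∀ k, ∀ c : MvPolynomial ι K, c.IsHomogeneous k → b * c ∈ I → c ∈ I := by
    intro k
    induction k using Nat.strong_induction_on with
    | _ k ih =>
      intro c hc hbc
      -- Graded Nakayama: modulo `I`, `c` is `a * v`, and `v` again satisfies `b * v ∈ I` but has
      -- smaller degree because `0 < e`.
      obtain ⟨v, hv, hcv, hk⟩ := hI.exists_of_mem_sup ha hc (hnb c (Submodule.mem_sup_left hbc))
      have hvI : v ∈ I := by
        by_cases hke : k < e
        · rw [hk hke]; exact zero_mem _
        · refine ih (k - e) (by omega) v hv (hna _ ?_)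
          have : a * (b * v) = b * c - b * (c - a * v) := by ring
          rw [this]
          exact sub_mem hbc (Ideal.mul_mem_left _ _ hcv)
      have : c = (c - a * v) + a * v := by ring
      rw [this]
      exact add_mem hcv (Ideal.mul_mem_left _ _ hvI)
  intro c hc
  refine IsHomogeneousIdeal.mem_of_components fun k => hom k _
    (homogeneousComponent_isHomogeneous _ _) ?_
  have := hI _ hc (d + k)
  rwa [homogeneousComponent_mul_of_isHomogeneous hb, if_pos (by omega),
    Nat.add_sub_cancel_left] at this

theorem isHomogeneousIdeal_span_image {a : ι → MvPolynomial ι K} {e : ι → ℕ}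
    (ha : ∀ i, (a i).IsHomogeneous (e i)) (T : Set ι) :
    IsHomogeneousIdeal (Ideal.span (a '' T)) :=
  isHomogeneousIdeal_span (by rintro _ ⟨i, _, rfl⟩; exact ⟨_, ha i⟩)

/-- Regularity of `b` modulo all other members passes to every smaller set by discarding one member
at a time with `IsNzdMod.descend`. An old member stays regular modulo a set containing `b` by
`IsNzdMod.exchange`. -/
theorem StronglyRegular.update [Finite ι] [DecidableEq ι] {a : ι → MvPolynomial ι K} {e : ι → ℕ}
    (hreg : StronglyRegular a) (he : ∀ i, 0 < e i) (ha : ∀ i, (a i).IsHomogeneous (e i)) (i : ι)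
    {b : MvPolynomial ι K} {d : ℕ} (hb : b.IsHomogeneous d)
    (hnb : IsNzdMod (Ideal.span (a '' {i}ᶜ)) b) :
    StronglyRegular (Function.update a i b) := by
  have himg : ∀ T : Set ι, i ∉ T → Function.update a i b '' T = a '' T := fun T hT =>
    Set.image_congr fun j hj => Function.update_of_ne (ne_of_mem_of_not_mem hj hT) _ _
  have hbT : ∀ n : ℕ, ∀ T : Set ι, i ∉ T → ({i}ᶜ \ T).ncard = n →
      IsNzdMod (Ideal.span (a '' T)) b := by
    intro n
    induction n with
    | zero =>
      intro T hT hc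
      have h1 : ({i}ᶜ : Set ι) ⊆ T := by
        rw [Set.ncard_eq_zero] at hc
        exact Set.sdiff_eq_empty.1 hc
      have h2 : T = {i}ᶜ := Set.Subset.antisymm (fun j hj => by
        rintro rfl; exact hT hj) h1
      rwa [h2]
    | succ n ih =>
      intro T hT hc
      obtain ⟨j, hj⟩ := (Set.ncard_pos (s := ({i}ᶜ \ T : Set ι))).1 (by omega)
      have h3 : i ∉ insert j T := by
        rintro (rfl | h)
        · exact hj.1 rfl
        · exact hT h
      have h4 : IsNzdMod (Ideal.span (a '' insert j T)) b := by
        refine ih _ h3 ?_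
        have : ({i}ᶜ \ insert j T : Set ι) = ({i}ᶜ \ T) \ {j} := by
          ext x; simp only [Set.mem_sdiff, Set.mem_insert_iff, Set.mem_singleton_iff]; tauto
        rw [this, Set.ncard_sdiff_singleton_of_mem hj]
        omega
      rw [span_image_insert] at h4
      exact IsNzdMod.descend (isHomogeneousIdeal_span_image ha T) (he j) (ha j) hb
        (hreg j T hj.2) h4
  intro j T hj
  by_cases hji : j = i
  · subst hji
    rw [himg T hj, Function.update_self]
    exact hbT _ T hj rfl
  rw [Function.update_of_ne hji]
  by_cases hiT : i ∈ T
  · have hT : T = insert i (T \ {i}) := by simp [Set.insert_eq_of_mem hiT]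
    have hi' : i ∉ T \ {i} := by simp
    have hj' : j ∉ T \ {i} := fun h => hj h.1
    rw [hT, span_image_insert, himg _ hi', Function.update_self]
    refine IsNzdMod.exchange (hreg j _ hj') ?_
    rw [← span_image_insert]
    refine hbT _ _ ?_ rfl
    rintro (h | h)
    · exact hji h.symm
    · exact hi' h
  · rw [himg T hiT]
    exact hreg j T hj

/-- Membership in an ideal generated by variables is tested on each monomial, and multiplying by `X
i` changes only the exponent of `X i`. -/
theorem stronglyRegular_X : StronglyRegular (X : ι → MvPolynomial ι K) := by
  intro i T hi c hc
  classical
  rw [mem_ideal_span_X_image] at hc ⊢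
  intro m hm
  obtain ⟨j, hj, hmj⟩ := hc (m + Finsupp.single i 1) (by
    rw [mem_support_iff] at hm ⊢
    rwa [add_comm, coeff_X_mul])
  refine ⟨j, hj, ?_⟩
  have : j ≠ i := ne_of_mem_of_not_mem hj hi
  simpa [Finsupp.single_apply, this.symm] using hmj

/-- Prime avoidance: a linear system that, modulo `I`, has a regular element in its radical
contains a regular element modulo `I`. -/
theorem exists_isNzdMod_of_mem_radical [Finite ι] [Infinite K] {I : Ideal (MvPolynomial ι K)}
    (W : Submodule K (MvPolynomial ι K)) {b : MvPolynomial ι K} (hb : IsNzdMod I b)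
    (hrad : b ∈ (I ⊔ Ideal.span (W : Set (MvPolynomial ι K))).radical) :
    ∃ w ∈ W, IsNzdMod I w := by
  classical
  have hnzd : ∀ r : MvPolynomial ι K, IsSMulRegular (MvPolynomial ι K ⧸ I) r ↔ IsNzdMod I r := by
    intro r
    rw [isSMulRegular_iff_right_eq_zero_of_smul]
    constructor
    · intro h c hc
      refine Ideal.Quotient.eq_zero_iff_mem.1 (h (Ideal.Quotient.mk I c) ?_)
      exact Ideal.Quotient.eq_zero_iff_mem.2 hc
    · intro h c
      obtain ⟨c, rfl⟩ := Ideal.Quotient.mk_surjective c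
      intro hc
      exact Ideal.Quotient.eq_zero_iff_mem.2 (h c (Ideal.Quotient.eq_zero_iff_mem.1 hc))
  have hass := biUnion_associatedPrimes_eq_compl_regular (MvPolynomial ι K) (MvPolynomial ι K ⧸ I)
  have hfin := associatedPrimes.finite (MvPolynomial ι K) (MvPolynomial ι K ⧸ I)
  have : Finite (associatedPrimes (MvPolynomial ι K) (MvPolynomial ι K ⧸ I)) := hfin
  -- The traces on `W` of the finitely many associated primes. Over an infinite field they cannot
  -- cover `W` unless one is all of `W`; that prime would then contain the regular element `b`.
  let q : associatedPrimes (MvPolynomial ι K) (MvPolynomial ι K ⧸ I) → Submodule K W :=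
    fun P => (P.1.restrictScalars K).comap W.subtype
  obtain ⟨w, hw⟩ := Submodule.exists_forall_notMem_of_forall_ne_top q (by
    rintro ⟨P, hP⟩ htop
    have hWP : (W : Set (MvPolynomial ι K)) ⊆ P := by
      intro w hw
      have : (⟨w, hw⟩ : W) ∈ q ⟨P, hP⟩ := htop ▸ Submodule.mem_top
      exact this
    have hIP : I ≤ P := by
      intro x hx
      have := hP.annihilator_le
      apply this
      rw [Submodule.mem_annihilator]
      rintro m -
      obtain ⟨m, rfl⟩ := Ideal.Quotient.mk_surjective m
      exact Ideal.Quotient.eq_zero_iff_mem.2 (Ideal.mul_mem_right _ _ hx)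
    have hbP : b ∈ P := by
      have h1 : (I ⊔ Ideal.span (W : Set (MvPolynomial ι K))).radical ≤ P :=
        (hP.isPrime.radical_le_iff).2 (sup_le hIP (Ideal.span_le.2 hWP))
      exact h1 hrad
    have hbU : b ∈ ⋃ p ∈ associatedPrimes (MvPolynomial ι K) (MvPolynomial ι K ⧸ I),
        (p : Set (MvPolynomial ι K)) := Set.mem_biUnion hP hbP
    rw [hass] at hbU
    exact hbU ((hnzd b).2 hb))
  refine ⟨w, w.2, (hnzd _).1 ?_⟩
  by_contra hcon
  have hwU : (w : MvPolynomial ι K) ∈ ({r | IsSMulRegular (MvPolynomial ι K ⧸ I) r}ᶜ : Set _) :=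
    hcon
  rw [← hass] at hwU
  obtain ⟨P, hP, hwP⟩ := Set.mem_iUnion₂.1 hwU
  exact hw ⟨P, hP⟩ hwP

end RegularHomogeneous

/-! ### Socle degrees of complete intersections -/

section Socle

variable {K : Type*} [Field K] {n : ℕ}

theorem span_range_eq_sup {R ι : Type*} [CommRing R] (a : ι → R) (j : ι) :
    Ideal.span (Set.range a) = Ideal.span (a '' {j}ᶜ) ⊔ Ideal.span {a j} := by
  classical
  rw [← span_image_insert]
  congr 1
  rw [← Set.image_univ]
  congr 1
  ext x
  simp [em]

theorem span_range_update {R ι : Type*} [CommRing R] [DecidableEq ι] (a : ι → R) (j : ι) (w : R) :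
    Ideal.span (Set.range (Function.update a j w)) =
      Ideal.span (a '' {j}ᶜ) ⊔ Ideal.span {w} := by
  rw [span_range_eq_sup _ j, Function.update_self]
  congr 2
  exact Set.image_congr fun k hk => Function.update_of_ne hk _ _

/-- A lower bound for the degrees of the socle elements of `S ⧸ I`. -/
def SocleBound {ι : Type*} (I : Ideal (MvPolynomial ι K)) (σ : ℕ) : Prop :=
  ∀ q, ∀ u : MvPolynomial ι K, u.IsHomogeneous q → u ∉ I → (∀ k, X k * u ∈ I) → σ ≤ q

/-- Replacing a variable by a form of degree `d` in a complete intersection raises the socle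
degree by `d - 1`. -/
theorem SocleBound.exchange {ι : Type*} {I : Ideal (MvPolynomial ι K)} (hI : IsHomogeneousIdeal I)
    {j : ι} {w : MvPolynomial ι K} {d σ : ℕ} (hd : 0 < d) (hw : w.IsHomogeneous d)
    (hnw : IsNzdMod I w) (hnX : IsNzdMod I (X j))
    (hs : SocleBound (I ⊔ Ideal.span {X j}) σ) : SocleBound (I ⊔ Ideal.span {w}) (σ + (d - 1)) := by
  intro q u hu huI hsoc
  -- Writing `X j * u = w * v` modulo `I`, the map `u ↦ v` sends socle elements modulo `I + (w)` to
  -- socle elements modulo `I + (X j)`, and lowers the degree by `d - 1`.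
  obtain ⟨v, hv, huv, hv0⟩ := hI.exists_of_mem_sup hw ((isHomogeneous_X K j).mul hu) (hsoc j)
  have hvI : v ∉ I ⊔ Ideal.span {X j} := by
    intro hmem
    obtain ⟨i, hi, t, ht, rfl⟩ := Submodule.mem_sup.1 hmem
    obtain ⟨s, rfl⟩ := Ideal.mem_span_singleton'.1 ht
    have h1 : X j * (u - s * w) ∈ I := by
      have : X j * (u - s * w) = (X j * u - w * (i + s * X j)) + w * i := by ring
      rw [this]
      exact add_mem huv (Ideal.mul_mem_left _ _ hi)
    apply huI
    have : u = (u - s * w) + s * w := by ring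
    rw [this]
    exact Submodule.add_mem_sup (hnX _ h1) (Ideal.mem_span_singleton'.2 ⟨s, rfl⟩)
  have hvs : ∀ k, X k * v ∈ I ⊔ Ideal.span {X j} := by
    intro k
    obtain ⟨i, hi, t, ht, hit⟩ := Submodule.mem_sup.1 (hsoc k)
    obtain ⟨c, rfl⟩ := Ideal.mem_span_singleton'.1 ht
    have h1 : w * (X k * v - c * X j) ∈ I := by
      have : w * (X k * v - c * X j) = X j * i - X k * (X j * u - w * v) := by
        linear_combination -X j * hit
      rw [this]
      exact sub_mem (Ideal.mul_mem_left _ _ hi) (Ideal.mul_mem_left _ _ huv)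
    have : X k * v = (X k * v - c * X j) + c * X j := by ring
    rw [this]
    exact Submodule.add_mem_sup (hnw _ h1) (Ideal.mem_span_singleton'.2 ⟨c, rfl⟩)
  have hdq : ¬ 1 + q < d := fun h => hvI (hv0 h ▸ zero_mem _)
  have := hs _ v hv hvI hvs
  omega

/-- Multiply `u` by variables as long as the product stays outside `I`. This stops after at most `s
- 1` factors, at a socle element of degree below `q + s`. -/
theorem SocleBound.lt_of_pow_mul_mem {ι : Type*} {I : Ideal (MvPolynomial ι K)} {σ : ℕ}
    (hs : SocleBound I σ) (s : ℕ) : ∀ q, ∀ u : MvPolynomial ι K, u.IsHomogeneous q → u ∉ I →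
      (∀ x ∈ Ideal.span (Set.range (X : ι → MvPolynomial ι K)) ^ s, x * u ∈ I) → σ < q + s := by
  induction s with
  | zero =>
    intro q u _ huI h
    exact absurd (by simpa using h 1 (by simp)) huI
  | succ s ih =>
    intro q u hu huI h
    by_cases hk : ∀ k, X k * u ∈ I
    · have := hs q u hu huI hk
      omega
    · push Not at hk
      obtain ⟨k, hk⟩ := hk
      have := ih (1 + q) (X k * u) ((isHomogeneous_X K k).mul hu) hk (by
        intro x hx
        rw [← mul_assoc]
        refine h _ ?_
        rw [pow_succ]
        exact Ideal.mul_mem_mul hx (Ideal.subset_span ⟨k, rfl⟩))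
      omega

/-- Inside a linear system `W` of forms of degree `d` that, together with the linear form `l`, has
no common zero, there are forms completing `l` to a regular sequence with known socle degree. -/
theorem exists_stronglyRegular [Infinite K] {l : MvPolynomial (Fin (n + 1)) K}
    (hl : l.IsHomogeneous 1)
    (hln : IsNzdMod (Ideal.span ((X : Fin (n + 1) → MvPolynomial (Fin (n + 1)) K) '' {0}ᶜ)) l)
    (W : Submodule K (MvPolynomial (Fin (n + 1)) K)) {d : ℕ} (hd : 0 < d)
    (hW : ∀ w ∈ W, w.IsHomogeneous d)
    (hrad : ∀ j, X j ∈ (Ideal.span {l} ⊔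
      Ideal.span (W : Set (MvPolynomial (Fin (n + 1)) K))).radical)
    (T : Finset (Fin (n + 1))) (hT : 0 ∉ T) :
    ∃ a : Fin (n + 1) → MvPolynomial (Fin (n + 1)) K, a 0 = l ∧ (∀ j ∈ T, a j ∈ W) ∧
      (∀ j ∉ T, j ≠ 0 → a j = X j) ∧ StronglyRegular a ∧
      SocleBound (Ideal.span (Set.range a)) (T.card * (d - 1)) := by
  induction T using Finset.induction_on with
  | empty =>
    refine ⟨Function.update X 0 l, Function.update_self .., by simp,
      fun j _ hj => Function.update_of_ne hj _ _, ?_, ?_⟩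
    · exact stronglyRegular_X.update (e := fun _ => 1) (fun _ => one_pos)
        (fun i => isHomogeneous_X K i) 0 hl hln
    · intro q u _ _ _
      simp
  | insert j T hj ih =>
    have hj0 : j ≠ 0 := fun h => hT (h ▸ Finset.mem_insert_self _ _)
    obtain ⟨a, ha0, haW, haX, hreg, hsoc⟩ := ih fun h => hT (Finset.mem_insert_of_mem h)
    have haj : a j = X j := haX j hj hj0
    let e : Fin (n + 1) → ℕ := fun i => if i ∈ T then d else 1
    have hae : ∀ i, (a i).IsHomogeneous (e i) := by
      intro i
      by_cases hi : i ∈ T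
      · simpa [e, hi] using hW _ (haW i hi)
      · by_cases hi0 : i = 0
        · subst hi0; simpa [e, hi, ha0] using hl
        · simpa [e, hi, haX i hi hi0] using isHomogeneous_X K i
    have he : ∀ i, 0 < e i := by
      intro i; simp only [e]; split_ifs <;> omega
    have hnX : IsNzdMod (Ideal.span (a '' {j}ᶜ)) (X j) := haj ▸ hreg j {j}ᶜ (by simp)
    -- The variable being replaced is the regular element that prime avoidance requires. It lies in
    -- the radical because `l = a 0` is among the members kept.
    obtain ⟨w, hwW, hw⟩ := exists_isNzdMod_of_mem_radical W hnX (by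
      refine Ideal.radical_mono (sup_le_sup_right ?_ _) (hrad j)
      rw [Ideal.span_singleton_le_iff_mem]
      exact Ideal.subset_span ⟨0, by simpa using hj0.symm, ha0⟩)
    refine ⟨Function.update a j w, ?_, ?_, ?_, ?_, ?_⟩
    · rw [Function.update_of_ne hj0.symm, ha0]
    · intro i hi
      by_cases hij : i = j
      · subst hij; rwa [Function.update_self]
      · rw [Function.update_of_ne hij]
        exact haW i ((Finset.mem_insert.1 hi).resolve_left hij)
    · intro i hi hi0
      rw [Finset.mem_insert, not_or] at hi
      rw [Function.update_of_ne hi.1]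
      exact haX i hi.2 hi0
    · exact hreg.update he hae j (hW w hwW) hw
    · rw [span_range_update, Finset.card_insert_of_notMem hj, add_mul, one_mul]
      rw [span_range_eq_sup a j, haj] at hsoc
      exact SocleBound.exchange (isHomogeneousIdeal_span_image hae _) hd (hW w hwW) hw hnX hsoc

/-- If `u` is annihilated by `J` modulo `I` and the saturation of `J` with respect to the linear
form `l` contains all forms of degree `s` modulo `l`, then `u` has large degree. -/
theorem lt_add_of_mul_mem {ι : Type*} {I J Q : Ideal (MvPolynomial ι K)}
    (hI : IsHomogeneousIdeal I)
    {l : MvPolynomial ι K} (hl : l.IsHomogeneous 1) (hnl : IsNzdMod I l) {σ s : ℕ}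
    (hsoc : SocleBound (I ⊔ Ideal.span {l}) σ)
    (hQ : ∀ x ∈ Q, ∃ t : ℕ, l ^ t * x ∈ J)
    (hs : Ideal.span (Set.range (X : ι → MvPolynomial ι K)) ^ s ≤ Q ⊔ Ideal.span {l}) :
    ∀ q, ∀ u : MvPolynomial ι K, u.IsHomogeneous q → u ∉ I → (∀ x ∈ J, x * u ∈ I) →
      σ < q + s := by
  intro q
  induction q with
  | zero =>
    intro u hu huI hJ
    by_cases hmem : u ∈ I ⊔ Ideal.span {l}
    · obtain ⟨v, _, huv, hv0⟩ := hI.exists_of_mem_sup hl hu hmem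
      rw [hv0 one_pos] at huv
      simp at huv
      exact absurd huv huI
    · refine hsoc.lt_of_pow_mul_mem s 0 u hu hmem fun y hy => ?_
      obtain ⟨x, hx, z, hz, rfl⟩ := Submodule.mem_sup.1 (hs hy)
      obtain ⟨t, ht⟩ := hQ x hx
      rw [add_mul]
      -- A power of `l` moves `x` into `J`, which kills `u` modulo `I`; cancelling that power shows
      -- that `x` kills `u` as well.
      refine Submodule.add_mem_sup (hnl.pow t _ ?_) (Ideal.mul_mem_right _ _ hz)
      rw [← mul_assoc]
      exact hJ _ ht
  | succ q ih =>
    intro u hu huI hJ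
    by_cases hmem : u ∈ I ⊔ Ideal.span {l}
    · obtain ⟨v, hv, huv, _⟩ := hI.exists_of_mem_sup hl hu hmem
      rw [Nat.add_sub_cancel] at hv
      have := ih v hv (fun h => huI (by
        have e : u = (u - l * v) + l * v := by ring
        rw [e]
        exact add_mem huv (Ideal.mul_mem_left _ _ h))) (by
        intro x hx
        apply hnl
        have e : l * (x * v) = x * u - x * (u - l * v) := by ring
        rw [e]
        exact sub_mem (hJ x hx) (Ideal.mul_mem_left _ _ huv))
      omega
    · refine hsoc.lt_of_pow_mul_mem s _ u hu hmem fun y hy => ?_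
      obtain ⟨x, hx, z, hz, rfl⟩ := Submodule.mem_sup.1 (hs hy)
      obtain ⟨t, ht⟩ := hQ x hx
      rw [add_mul]
      refine Submodule.add_mem_sup (hnl.pow t _ ?_) (Ideal.mul_mem_right _ _ hz)
      rw [← mul_assoc]
      exact hJ _ ht

end Socle

/-! ### Koszul relations -/

section Koszul

variable {R ι : Type*} [CommRing R] [DecidableEq ι]

/-- The module of Koszul relations of a family of ring elements. -/
def koszulRelations (h : ι → R) : Submodule R (ι → R) :=
  Submodule.span R (Set.range fun ij : ι × ι =>
    (Pi.single ij.1 (h ij.2) - Pi.single ij.2 (h ij.1) : ι → R))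

theorem single_sub_single_mem_koszulRelations (h : ι → R) (i j : ι) :
    (Pi.single i (h j) - Pi.single j (h i) : ι → R) ∈ koszulRelations h :=
  Submodule.subset_span ⟨(i, j), rfl⟩

/-- Expand `r j` in the `h i` with `i ∈ T` and subtract the matching Koszul relations between `j`
and `i`. This clears the entry at `j` and otherwise alters only entries in `T`. -/
theorem exists_sub_mem_koszulRelations {h r : ι → R} {T : Finset ι} {j : ι} (hj : j ∉ T)
    (hr : ∀ i ∉ insert j T, r i = 0) (hrj : r j ∈ Ideal.span (h '' T)) :
    ∃ r', r - r' ∈ koszulRelations h ∧ ∀ i ∉ T, r' i = 0 := by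
  obtain ⟨c, hc⟩ := (Submodule.mem_span_image_finset_iff_exists_fun' R).1 hrj
  let z : ι → R := ∑ i ∈ T, c i • (Pi.single j (h i) - Pi.single i (h j))
  have hz : z ∈ koszulRelations h :=
    Submodule.sum_mem _ fun i _ => Submodule.smul_mem _ _
      (single_sub_single_mem_koszulRelations h j i)
  refine ⟨r - z, by simpa using hz, fun i hi => ?_⟩
  by_cases hij : i = j
  · subst hij
    have : z i = ∑ k ∈ T, c k • h k := by
      simp only [z, Finset.sum_apply, Pi.smul_apply, Pi.sub_apply, Pi.single_eq_same]
      refine Finset.sum_congr rfl fun k hk => ?_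
      rw [Pi.single_eq_of_ne (ne_of_mem_of_not_mem hk hj).symm, sub_zero]
    rw [Pi.sub_apply, this, hc, sub_self]
  · have : z i = 0 := by
      simp only [z, Finset.sum_apply, Pi.smul_apply, Pi.sub_apply]
      refine Finset.sum_eq_zero fun k hk => ?_
      rw [Pi.single_eq_of_ne hij, Pi.single_eq_of_ne (ne_of_mem_of_not_mem hk hi).symm, sub_zero,
        smul_zero]
    rw [Pi.sub_apply, this, sub_zero, hr i (by simp [hij, hi])]

variable [Fintype ι]

theorem dotProduct_eq_zero_of_mem_koszulRelations {h r : ι → R} (hr : r ∈ koszulRelations h) :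
    r ⬝ᵥ h = 0 := by
  induction hr using Submodule.span_induction with
  | mem x hx =>
    obtain ⟨⟨i, j⟩, rfl⟩ := hx
    simp [sub_dotProduct, mul_comm]
  | zero => simp
  | add x y _ _ hx hy => rw [add_dotProduct, hx, hy, add_zero]
  | smul t x _ hx => rw [smul_dotProduct, hx, smul_zero]

/-- Relations between the members of a regular sequence are Koszul. -/
theorem mem_koszulRelations_of_support {h : ι → R} (T : Finset ι)
    (hreg : ∀ j ∈ T, ∀ T' ⊆ T, j ∉ T' → IsNzdMod (Ideal.span (h '' T')) (h j)) :
    ∀ r : ι → R, r ⬝ᵥ h = 0 → (∀ i ∉ T, r i = 0) → r ∈ koszulRelations h := by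
  induction T using Finset.induction_on with
  | empty =>
    intro r _ hr
    have : r = 0 := funext fun i => hr i (by simp)
    rw [this]
    exact zero_mem _
  | insert j T hj ih =>
    intro r hrh hr
    have hrj : r j ∈ Ideal.span (h '' T) := by
      apply hreg j (Finset.mem_insert_self _ _) T (Finset.subset_insert _ _) hj
      have h1 : ∑ i ∈ insert j T, r i * h i = 0 := by
        rw [← hrh]
        exact Finset.sum_subset (Finset.subset_univ _) fun i _ hi => by rw [hr i hi, zero_mul]
      rw [Finset.sum_insert hj] at h1
      have h2 : h j * r j = -∑ i ∈ T, r i * h i := by linear_combination h1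
      rw [h2]
      exact neg_mem (Ideal.sum_mem _ fun i hi =>
        Ideal.mul_mem_left _ _ (Ideal.subset_span ⟨i, hi, rfl⟩))
    obtain ⟨r', h1, h2⟩ := exists_sub_mem_koszulRelations hj hr hrj
    have h3 : r' ⬝ᵥ h = 0 := by
      have := dotProduct_eq_zero_of_mem_koszulRelations h1
      rwa [sub_dotProduct, hrh, zero_sub, neg_eq_zero] at this
    have h4 := ih (fun i hi T' hT' hiT' => hreg i (Finset.mem_insert_of_mem hi) T'
      (hT'.trans (Finset.subset_insert _ _)) hiT') r' h3 h2
    simpa using add_mem h1 h4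

/-- The member `h j` need not be regular: once its coefficient has been cleared, what remains is a
relation within the regular sequence formed by the others. -/
theorem mem_koszulRelations_of_apply_mem {h r : ι → R} {j : ι} (hrh : r ⬝ᵥ h = 0)
    (hreg : ∀ i ≠ j, ∀ T : Set ι, j ∉ T → i ∉ T → IsNzdMod (Ideal.span (h '' T)) (h i))
    (hrj : r j ∈ Ideal.span (h '' {j}ᶜ)) : r ∈ koszulRelations h := by
  obtain ⟨r', h1, h2⟩ := exists_sub_mem_koszulRelations (T := Finset.univ.erase j) (j := j)
    (h := h) (r := r) (by simp) (by simp) (by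
      convert hrj
      ext; simp)
  have h3 : r' ⬝ᵥ h = 0 := by
    have := dotProduct_eq_zero_of_mem_koszulRelations h1
    rwa [sub_dotProduct, hrh, zero_sub, neg_eq_zero] at this
  have h4 := mem_koszulRelations_of_support (Finset.univ.erase j) (fun i hi T' hT' hiT' =>
    hreg i (Finset.ne_of_mem_erase hi) T' (fun hj => by simpa using hT' hj) (by simpa using hiT'))
    r' h3 h2
  simpa using add_mem h1 h4

/-- By bilinearity, the Koszul relation of `A.mulVec f` at `(a, b)` becomes the combination of those
of `f` with coefficients `A b k * A a j`. This allows the partials to be replaced by adapted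
generators. -/
theorem transpose_mulVec_mem_koszulRelations {A : Matrix ι ι R} {f r : ι → R}
    (hr : r ∈ koszulRelations (A.mulVec f)) : A.transpose.mulVec r ∈ koszulRelations f := by
  induction hr using Submodule.span_induction with
  | mem x hx =>
    obtain ⟨⟨a, b⟩, rfl⟩ := hx
    have hsingle : ∀ (M : Matrix ι ι R) (i m : ι) (x : R),
        M.mulVec (Pi.single i x) m = M m i * x := fun M i m x => by
      simp [Matrix.mulVec_single, mul_comm]
    have : A.transpose.mulVec (Pi.single a (A.mulVec f b) - Pi.single b (A.mulVec f a)) =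
        ∑ j, ∑ k, (A b k * A a j) • (Pi.single j (f k) - Pi.single k (f j) : ι → R) := by
      ext m
      simp only [Matrix.mulVec_sub, Pi.sub_apply, Finset.sum_apply, Pi.smul_apply, smul_sub,
        Finset.sum_sub_distrib, smul_eq_mul]
      congr 1
      · rw [Finset.sum_eq_single m]
        · rw [hsingle, Matrix.transpose_apply, Matrix.mulVec, dotProduct, Finset.mul_sum]
          exact Finset.sum_congr rfl fun k _ => by rw [Pi.single_eq_same]; ring
        · intro j _ hj
          simp [Pi.single_eq_of_ne hj.symm]
        · simp
      · rw [Finset.sum_comm, Finset.sum_eq_single m]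
        · rw [hsingle, Matrix.transpose_apply, Matrix.mulVec, dotProduct, Finset.mul_sum]
          exact Finset.sum_congr rfl fun k _ => by rw [Pi.single_eq_same]; ring
        · intro j _ hj
          simp [Pi.single_eq_of_ne hj.symm]
        · simp
    rw [this]
    exact Submodule.sum_mem _ fun j _ => Submodule.sum_mem _ fun k _ =>
      Submodule.smul_mem _ _ (single_sub_single_mem_koszulRelations f j k)
  | zero => simp
  | add x y _ _ hx hy => rw [Matrix.mulVec_add]; exact add_mem hx hy
  | smul t x _ hx => rw [Matrix.mulVec_smul]; exact Submodule.smul_mem _ _ hx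

end Koszul

/-! ### Hilbert functions -/

section Hilbert

variable {K ι : Type*} [Field K]

/-- The homogeneous component of degree `k` of an ideal. -/
def idealComponent (I : Ideal (MvPolynomial ι K)) (k : ℕ) : Submodule K (MvPolynomial ι K) :=
  homogeneousSubmodule ι K k ⊓ I.restrictScalars K

theorem idealComponent_sup_of_lt {I : Ideal (MvPolynomial ι K)} (hI : IsHomogeneousIdeal I)
    {h : MvPolynomial ι K} {d k : ℕ} (hh : h.IsHomogeneous d) (hk : k < d) :
    idealComponent (I ⊔ Ideal.span {h}) k = idealComponent I k := by
  ext x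
  refine ⟨fun hx => ⟨hx.1, ?_⟩, fun hx => ⟨hx.1, Submodule.mem_sup_left hx.2⟩⟩
  obtain ⟨v, _, hv, hv0⟩ := hI.exists_of_mem_sup hh hx.1 hx.2
  simpa [hv0 hk] using hv

variable [Finite ι]

instance finite_homogeneousSubmodule (k : ℕ) : Module.Finite K (homogeneousSubmodule ι K k) :=
  Module.Finite.iff_fg.2 (homogeneousSubmodule_fg ι K k)

instance finite_idealComponent (I : Ideal (MvPolynomial ι K)) (k : ℕ) :
    Module.Finite K (idealComponent I k) :=
  Submodule.finiteDimensional_inf_left _ _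

theorem finrank_map_mk_add_finrank_idealComponent (I : Ideal (MvPolynomial ι K)) (k : ℕ) :
    Module.finrank K ((homogeneousSubmodule ι K k).map (Ideal.Quotient.mkₐ K I).toLinearMap) +
      Module.finrank K (idealComponent I k) = Module.finrank K (homogeneousSubmodule ι K k) := by
  have h := LinearMap.finrank_range_add_finrank_ker
    ((Ideal.Quotient.mkₐ K I).toLinearMap.domRestrict (homogeneousSubmodule ι K k))
  rw [LinearMap.range_domRestrict] at h
  rw [← h]
  congr 1
  have e : idealComponent I k = (LinearMap.ker ((Ideal.Quotient.mkₐ K I).toLinearMap.domRestrict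
      (homogeneousSubmodule ι K k))).map (homogeneousSubmodule ι K k).subtype := by
    ext x
    simp only [idealComponent, Submodule.mem_inf, Submodule.restrictScalars_mem, Submodule.mem_map,
      LinearMap.mem_ker, LinearMap.domRestrict_apply, AlgHom.toLinearMap_apply,
      Ideal.Quotient.mkₐ_eq_mk, Ideal.Quotient.eq_zero_iff_mem, Submodule.subtype_apply,
      Subtype.exists, exists_and_left, exists_prop, exists_eq_right_right]
    tauto
  rw [e]
  exact Submodule.finrank_map_subtype_eq _ _

/-- Rank–nullity for `(v, e) ↦ h * v + e` on pairs of a form of degree `k - d` and an element of `I`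
of degree `k`; the kernel is a copy of the degree `k - d` part of `I`. Regularity of `h` is required
only in that single degree, since the last generator of a Jacobian ideal is regular only in low
degrees. -/
theorem finrank_idealComponent_sup {I : Ideal (MvPolynomial ι K)} (hI : IsHomogeneousIdeal I)
    {h : MvPolynomial ι K} {d k : ℕ} (hh : h.IsHomogeneous d) (hk : d ≤ k)
    (hnzd : ∀ v : MvPolynomial ι K, v.IsHomogeneous (k - d) → h * v ∈ I → v ∈ I) :
    Module.finrank K (idealComponent (I ⊔ Ideal.span {h}) k) +
      Module.finrank K (idealComponent I (k - d)) =
    Module.finrank K (homogeneousSubmodule ι K (k - d)) +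
      Module.finrank K (idealComponent I k) := by
  let Φ : homogeneousSubmodule ι K (k - d) × idealComponent I k →ₗ[K] MvPolynomial ι K :=
    ((LinearMap.mulLeft K h).comp (homogeneousSubmodule ι K (k - d)).subtype).coprod
      (idealComponent I k).subtype
  have hrange : LinearMap.range Φ = idealComponent (I ⊔ Ideal.span {h}) k := by
    ext x
    constructor
    · rintro ⟨⟨v, e⟩, rfl⟩
      have hv : (v : MvPolynomial ι K).IsHomogeneous (k - d) := v.2
      have := hh.mul hv
      rw [Nat.add_sub_cancel' hk] at this
      refine ⟨add_mem this e.2.1, ?_⟩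
      exact add_mem (Submodule.mem_sup_right (Ideal.mul_mem_right _ _
        (Ideal.mem_span_singleton_self h))) (Submodule.mem_sup_left e.2.2)
    · intro hx
      obtain ⟨v, hv, hxv, _⟩ := hI.exists_of_mem_sup hh hx.1 hx.2
      have hhv := hh.mul hv
      rw [Nat.add_sub_cancel' hk] at hhv
      refine ⟨(⟨v, hv⟩, ⟨x - h * v, sub_mem hx.1 hhv, hxv⟩), ?_⟩
      simp [Φ]
  have hker : Module.finrank K (LinearMap.ker Φ) = Module.finrank K (idealComponent I (k - d)) := by
    let pr : LinearMap.ker Φ →ₗ[K] MvPolynomial ι K :=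
      ((homogeneousSubmodule ι K (k - d)).subtype.comp (LinearMap.fst K _ _)).comp
        (LinearMap.ker Φ).subtype
    have hpr : Function.Injective pr := by
      rintro ⟨⟨v, e⟩, hve⟩ ⟨⟨v', e'⟩, hve'⟩ h0
      have hv : v = v' := Subtype.ext h0
      subst hv
      have h1 : h * (v : MvPolynomial ι K) + e = 0 := by simpa [Φ] using hve
      have h2 : h * (v : MvPolynomial ι K) + e' = 0 := by simpa [Φ] using hve'
      have he : e = e' := Subtype.ext (add_left_cancel (h1.trans h2.symm))
      subst he
      rfl
    rw [← LinearMap.finrank_range_of_inj hpr]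
    suffices LinearMap.range pr = idealComponent I (k - d) by rw [this]
    ext x
    constructor
    · rintro ⟨⟨⟨v, e⟩, hve⟩, rfl⟩
      refine ⟨v.2, hnzd v v.2 ?_⟩
      have h1 : h * (v : MvPolynomial ι K) + e = 0 := by simpa [Φ] using hve
      rw [eq_neg_of_add_eq_zero_left h1]
      exact neg_mem e.2.2
    · intro hx
      have hx1 : x.IsHomogeneous (k - d) := hx.1
      have hhx := hh.mul hx1
      rw [Nat.add_sub_cancel' hk] at hhx
      refine ⟨⟨(⟨x, hx.1⟩, ⟨-(h * x), neg_mem hhx, neg_mem (Ideal.mul_mem_left _ _ hx.2)⟩), ?_⟩, rfl⟩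
      simp [Φ]
  have := LinearMap.finrank_range_add_finrank_ker Φ
  rw [hrange, hker, Module.finrank_prod] at this
  exact this

/-- The Hilbert function of `I + (h)` is determined by that of `I`, in degrees where `h` is
regular modulo `I`. -/
theorem finrank_idealComponent_sup_congr {I I' : Ideal (MvPolynomial ι K)}
    (hI : IsHomogeneousIdeal I) (hI' : IsHomogeneousIdeal I') {h h' : MvPolynomial ι K} {d k : ℕ}
    (hh : h.IsHomogeneous d) (hh' : h'.IsHomogeneous d)
    (heq : ∀ k, Module.finrank K (idealComponent I k) = Module.finrank K (idealComponent I' k))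
    (hn : d ≤ k → ∀ v : MvPolynomial ι K, v.IsHomogeneous (k - d) → h * v ∈ I → v ∈ I)
    (hn' : d ≤ k → ∀ v : MvPolynomial ι K, v.IsHomogeneous (k - d) → h' * v ∈ I' → v ∈ I') :
    Module.finrank K (idealComponent (I ⊔ Ideal.span {h}) k) =
      Module.finrank K (idealComponent (I' ⊔ Ideal.span {h'}) k) := by
  by_cases hk : d ≤ k
  · have h1 := finrank_idealComponent_sup hI hh hk (hn hk)
    have h2 := finrank_idealComponent_sup hI' hh' hk (hn' hk)
    have h3 := heq k
    have h4 := heq (k - d)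
    omega
  · rw [idealComponent_sup_of_lt hI hh (by omega), idealComponent_sup_of_lt hI' hh' (by omega),
      heq]

/-- Adding the generators one by one, the Hilbert function of the ideal of a regular sequence
depends only on the degrees. -/
theorem StronglyRegular.finrank_idealComponent_congr [DecidableEq ι] {a a' : ι → MvPolynomial ι K}
    (ha : StronglyRegular a) (ha' : StronglyRegular a') {d : ℕ} (T : Finset ι)
    (hd : ∀ i ∈ T, (a i).IsHomogeneous d) (hd' : ∀ i ∈ T, (a' i).IsHomogeneous d) (k : ℕ) :
    Module.finrank K (idealComponent (Ideal.span (a '' T)) k) =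
      Module.finrank K (idealComponent (Ideal.span (a' '' T)) k) := by
  induction T using Finset.induction_on generalizing k with
  | empty => rw [Finset.coe_empty, Set.image_empty, Set.image_empty]
  | insert j T hj ih =>
    rw [Finset.coe_insert, span_image_insert, span_image_insert]
    refine finrank_idealComponent_sup_congr
      (isHomogeneousIdeal_span ?_) (isHomogeneousIdeal_span ?_)
      (hd j (Finset.mem_insert_self _ _)) (hd' j (Finset.mem_insert_self _ _))
      (ih (fun i hi => hd i (Finset.mem_insert_of_mem hi))
        (fun i hi => hd' i (Finset.mem_insert_of_mem hi)))
      (fun _ v _ => ha j T (fun h => hj (Finset.mem_coe.1 h)) v) (fun _ v _ => ha' j T (fun h => hj (Finset.mem_coe.1 h)) v)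
    · rintro _ ⟨i, hi, rfl⟩; exact ⟨d, hd i (Finset.mem_insert_of_mem hi)⟩
    · rintro _ ⟨i, hi, rfl⟩; exact ⟨d, hd' i (Finset.mem_insert_of_mem hi)⟩

end Hilbert

/-! ### The ring of holomorphic germs -/

section Germs

variable {n : ℕ}

/-- The first order Taylor formula with analytic coefficients. -/
theorem exists_eventuallyEq_add_sum {h : (Fin n → ℂ) → ℂ} (hh : AnalyticAt ℂ h 0) :
    ∃ G : Fin n → (Fin n → ℂ) → ℂ, (∀ i, AnalyticAt ℂ (G i) 0) ∧
      h =ᶠ[𝓝 0] fun y => h 0 + ∑ i, y i * G i y := by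
  obtain ⟨p, r, hp⟩ := hh
  -- The shifted series takes values in linear forms and satisfies `h y = h 0 + (p.shift.sum y) y`;
  -- its values on the basis vectors are the coefficients `G i`.
  have hrad : 0 < p.shift.radius := by
    rw [FormalMultilinearSeries.radius_shift]
    exact hp.r_pos.trans_le hp.r_le
  have hshift := p.shift.hasFPowerSeriesOnBall hrad
  have han : AnalyticAt ℂ p.shift.sum 0 := hshift.analyticAt
  refine ⟨fun i y => p.shift.sum y (Pi.single i 1), fun i => ?_, ?_⟩
  · exact ((ContinuousLinearMap.apply ℂ ℂ (Pi.single i (1 : ℂ) : Fin n → ℂ)).analyticAt _).comp han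
  · filter_upwards [Metric.eball_mem_nhds (0 : Fin n → ℂ) hp.r_pos,
      Metric.eball_mem_nhds (0 : Fin n → ℂ) hrad] with y hy hy'
    have h1 := hp.hasSum hy
    have h2 := (ContinuousLinearMap.apply ℂ ℂ y).hasSum (hshift.hasSum hy')
    rw [zero_add] at h1 h2
    have h3 : HasSum (fun k : ℕ => p (k + 1) fun _ => y) (p.shift.sum y y) := by
      have h0 : ∀ k, (p.shift k fun _ => y) y = p (k + 1) fun _ => y := by
        intro k
        simp only [FormalMultilinearSeries.shift, ContinuousMultilinearMap.curryRight_apply]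
        congr 1
        ext i : 1
        refine Fin.lastCases ?_ (fun j => ?_) i
        · exact Fin.snoc_last _ _
        · exact Fin.snoc_castSucc (α := fun _ => Fin n → ℂ) _ _ _
      simpa only [ContinuousLinearMap.apply_apply, h0] using h2
    have h4 := (hasSum_nat_add_iff' 1).2 h1
    have h5 := h3.unique h4
    have h6 : p 0 (fun _ => y) = h 0 := by
      rw [← hp.coeff_zero (fun _ => y)]
    rw [Finset.sum_range_one, h6] at h5
    have h7 : p.shift.sum y y = ∑ i, y i * p.shift.sum y (Pi.single i 1) := by
      generalize p.shift.sum y = Λ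
      conv_lhs => rw [pi_eq_sum_univ' y]
      simp
    rw [← h7, h5]
    ring

/-- The germ of an analytic function. -/
def HolGerm.of (h : (Fin n → ℂ) → ℂ) (hh : AnalyticAt ℂ h 0) : HolGerm n :=
  ⟨Germ.ofFun h, h, hh, rfl⟩

theorem HolGerm.exists_of (g : HolGerm n) : ∃ h hh, g = HolGerm.of h hh := by
  obtain ⟨_, h, hh, rfl⟩ := g
  exact ⟨h, hh, rfl⟩

theorem HolGerm.of_eq_of {h k : (Fin n → ℂ) → ℂ} {hh : AnalyticAt ℂ h 0} {hk : AnalyticAt ℂ k 0} :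
    HolGerm.of h hh = HolGerm.of k hk ↔ h =ᶠ[𝓝 0] k :=
  Subtype.ext_iff.trans Germ.coe_eq

/-- The value of a holomorphic germ at the origin. -/
def HolGerm.value (n : ℕ) : HolGerm n →+* ℂ :=
  (Germ.valueRingHom (x := (0 : Fin n → ℂ)) (E := ℂ)).comp (HolGerm n).subtype

theorem HolGerm.value_of {h : (Fin n → ℂ) → ℂ} (hh : AnalyticAt ℂ h 0) :
    HolGerm.value n (HolGerm.of h hh) = h 0 :=
  rfl

theorem HolGerm.mem_maxIdeal {g : HolGerm n} :
    g ∈ HolGerm.maxIdeal n ↔ HolGerm.value n g = 0 :=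
  Iff.rfl

theorem HolGerm.isUnit_of_value_ne_zero {g : HolGerm n} (hg : HolGerm.value n g ≠ 0) :
    IsUnit g := by
  obtain ⟨h, hh, rfl⟩ := HolGerm.exists_of g
  rw [HolGerm.value_of] at hg
  refine IsUnit.of_mul_eq_one (HolGerm.of (fun y => (h y)⁻¹) (hh.inv hg)) ?_
  have : HolGerm.of h hh * HolGerm.of (fun y => (h y)⁻¹) (hh.inv hg) =
      HolGerm.of (h * fun y => (h y)⁻¹) (hh.mul (hh.inv hg)) := rfl
  rw [this]
  have h1 : (1 : HolGerm n) = HolGerm.of 1 analyticAt_const := rfl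
  rw [h1, HolGerm.of_eq_of]
  filter_upwards [hh.continuousAt.eventually_ne hg] with y hy
  exact mul_inv_cancel₀ hy

theorem HolGerm.isUnit_det_of_value {m : Type*} [Fintype m] [DecidableEq m]
    {A : Matrix m m (HolGerm n)} (hA : (A.map (HolGerm.value n)).det ≠ 0) : IsUnit A.det := by
  refine HolGerm.isUnit_of_value_ne_zero ?_
  rwa [RingHom.map_det]

theorem analyticAt_coord (i : Fin n) : AnalyticAt ℂ (fun y : Fin n → ℂ => y i) 0 :=
  (ContinuousLinearMap.proj (R := ℂ) (φ := fun _ : Fin n => ℂ) i).analyticAt 0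

/-- The coordinate functions, as holomorphic germs. -/
def HolGerm.coord (i : Fin n) : HolGerm n :=
  HolGerm.of (fun y => y i) (analyticAt_coord i)

theorem HolGerm.coe_sum {ι : Type*} (s : Finset ι) (G : ι → (Fin n → ℂ) → ℂ)
    (hG : ∀ i, AnalyticAt ℂ (G i) 0) :
    ∑ i ∈ s, HolGerm.of (G i) (hG i) = HolGerm.of (fun y => ∑ i ∈ s, G i y)
      (Finset.analyticAt_fun_sum s fun i _ => hG i) := by
  classical
  induction s using Finset.induction_on with
  | empty => rfl
  | insert a s ha ih =>
    rw [Finset.sum_insert ha, ih]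
    simp_rw [Finset.sum_insert ha]
    rfl

/-- A germ vanishing at the origin is a combination of the coordinates, with the values of the
first partial derivatives as values of the coefficients. -/
theorem HolGerm.exists_eq_sum_coord {h : (Fin n → ℂ) → ℂ} (hh : AnalyticAt ℂ h 0) (h0 : h 0 = 0) :
    ∃ G : Fin n → HolGerm n, HolGerm.of h hh = ∑ i, G i * HolGerm.coord i ∧
      ∀ i, HolGerm.value n (G i) = fderiv ℂ h 0 (Pi.single i 1) := by
  obtain ⟨G, hG, he⟩ := exists_eventuallyEq_add_sum hh
  refine ⟨fun i => HolGerm.of (G i) (hG i), ?_, fun i => ?_⟩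
  · have : ∀ i, HolGerm.of (G i) (hG i) * HolGerm.coord i =
        HolGerm.of (G i * fun y => y i) ((hG i).mul (analyticAt_coord i)) := fun i => rfl
    simp_rw [this]
    rw [HolGerm.coe_sum, HolGerm.of_eq_of]
    refine he.trans (Eventually.of_forall fun y => ?_)
    simp [h0, mul_comm]
  · rw [he.fderiv_eq, HolGerm.value_of]
    have h1 : ∀ j, HasFDerivAt (fun y : Fin n → ℂ => y j * G j y)
        ((G j 0) • (ContinuousLinearMap.proj j : (Fin n → ℂ) →L[ℂ] ℂ)) 0 := by
      intro j
      have h2 : HasFDerivAt (fun y : Fin n → ℂ => y j) (ContinuousLinearMap.proj j) 0 :=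
        (ContinuousLinearMap.proj (R := ℂ) (φ := fun _ : Fin n => ℂ) j).hasFDerivAt
      have h3 : HasFDerivAt (fun y : Fin n → ℂ => y j * G j y)
          ((0 : ℂ) • fderiv ℂ (G j) 0 + (G j 0) • ContinuousLinearMap.proj j) 0 :=
        h2.mul (hG j).differentiableAt.hasFDerivAt
      exact h3.congr_fderiv (by ext v; simp)
    have h4 := (HasFDerivAt.fun_sum (u := Finset.univ) fun j _ => h1 j).const_add (h 0)
    rw [h4.fderiv]
    simp [Pi.single_apply]

theorem HolGerm.maxIdeal_eq_span_coord :
    HolGerm.maxIdeal n = Ideal.span (Set.range (HolGerm.coord (n := n))) := by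
  refine le_antisymm (fun g hg => ?_) (Ideal.span_le.2 ?_)
  · obtain ⟨h, hh, rfl⟩ := HolGerm.exists_of g
    obtain ⟨G, hG, _⟩ := HolGerm.exists_eq_sum_coord hh hg
    rw [hG]
    exact Ideal.sum_mem _ fun i _ => Ideal.mul_mem_left _ _ (Ideal.subset_span ⟨i, rfl⟩)
  · rintro _ ⟨i, rfl⟩
    rfl

/-- Elements of the `A`-th power of the maximal ideal vanish to order `A` at the origin. -/
theorem HolGerm.isBigO_of_mem_maxIdeal_pow (A : ℕ) {g : HolGerm n}
    (hg : g ∈ HolGerm.maxIdeal n ^ A) : ∃ h hh, g = HolGerm.of h hh ∧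
      h =O[𝓝 0] fun y : Fin n → ℂ => ‖y‖ ^ A := by
  induction A generalizing g with
  | zero =>
    obtain ⟨h, hh, rfl⟩ := HolGerm.exists_of g
    refine ⟨h, hh, rfl, ?_⟩
    simpa using hh.continuousAt.isBigO_one ℝ
  | succ A ih =>
    rw [pow_succ] at hg
    induction hg using Submodule.mul_induction_on' with
    | mem_mul_mem x hx y hy =>
      obtain ⟨h, hh, rfl, hO⟩ := ih hx
      obtain ⟨k, hk, rfl⟩ := HolGerm.exists_of y
      refine ⟨h * k, hh.mul hk, rfl, ?_⟩
      simp_rw [pow_succ]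
      refine hO.mul ?_
      have hk0 : k 0 = 0 := hy
      have := hk.differentiableAt.isBigO_sub
      simp only [hk0, sub_zero] at this
      exact this.norm_right
    | add x _ y _ hx hy =>
      obtain ⟨h, hh, rfl, hO⟩ := hx
      obtain ⟨k, hk, rfl, hO'⟩ := hy
      exact ⟨h + k, hh.add hk, rfl, hO.add hO'⟩

/-- Families of elements related by an invertible matrix generate the same ideal. -/
theorem span_range_mulVec_eq {R m : Type*} [CommRing R] [Fintype m] [DecidableEq m]
    {A : Matrix m m R} (hA : IsUnit A.det) (x : m → R) :
    Ideal.span (Set.range (A.mulVec x)) = Ideal.span (Set.range x) := by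
  have key : ∀ (B : Matrix m m R) (x : m → R),
      Ideal.span (Set.range (B.mulVec x)) ≤ Ideal.span (Set.range x) := by
    intro B x
    rw [Ideal.span_le]
    rintro _ ⟨i, rfl⟩
    exact Ideal.sum_mem _ fun j _ => Ideal.mul_mem_left _ _ (Ideal.subset_span ⟨j, rfl⟩)
  refine le_antisymm (key A x) ?_
  have := key A⁻¹ (A.mulVec x)
  rwa [Matrix.mulVec_mulVec, Matrix.nonsing_inv_mul _ hA, Matrix.one_mulVec] at this

end Germs

/-! ### Pulling back polynomials to local coordinates -/

section LinearForms

variable {K ι : Type*} [Field K] [Fintype ι]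

/-- The linear form with given coefficients. -/
def linearForm (c : ι → K) : MvPolynomial ι K :=
  ∑ j, C (c j) * X j

theorem isHomogeneous_linearForm (c : ι → K) : (linearForm c).IsHomogeneous 1 :=
  IsHomogeneous.sum _ _ _ fun _ _ => isHomogeneous_C_mul_X _ _

theorem eval_linearForm (c z : ι → K) : eval z (linearForm c) = ∑ j, c j * z j := by
  simp [linearForm]

theorem pderiv_linearForm (c : ι → K) (j : ι) : pderiv j (linearForm c) = C (c j) := by
  classical
  simp [linearForm, pderiv_X, Pi.single_apply]

end LinearForms

/-! ### Parametrizations of projective space and the Tjurina ideal -/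

section Pullback

variable {n : ℕ}

theorem analyticAt_eval {ι : Type*} {φ : (Fin n → ℂ) → (ι → ℂ)} [Fintype ι] {x : Fin n → ℂ}
    (hφ : AnalyticAt ℂ φ x) (P : MvPolynomial ι ℂ) :
    AnalyticAt ℂ (fun y => eval (φ y) P) x := by
  have h := AnalyticAt.aeval_mvPolynomial (𝕜 := ℂ) (f := φ)
    (fun i => ((ContinuousLinearMap.proj (R := ℂ) (φ := fun _ : ι => ℂ) i).analyticAt _).comp hφ) P
  simpa [aeval_eq_eval] using h

theorem hasFDerivAt_eval {ι : Type*} [Fintype ι] {φ : (Fin n → ℂ) → (ι → ℂ)} {x : Fin n → ℂ}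
    {φ' : (Fin n → ℂ) →L[ℂ] (ι → ℂ)} (hφ : HasFDerivAt φ φ' x) (P : MvPolynomial ι ℂ) :
    HasFDerivAt (fun y => eval (φ y) P)
      (∑ j, eval (φ x) (pderiv j P) • (ContinuousLinearMap.proj j).comp φ') x := by
  classical
  induction P using MvPolynomial.induction_on with
  | C a =>
    simp only [eval_C]
    exact (hasFDerivAt_const (𝕜 := ℂ) a x).congr_fderiv (by ext v; simp)
  | add p q hp hq =>
    simp only [map_add]
    exact (hp.add hq).congr_fderiv (by ext v; simp [add_mul, Finset.sum_add_distrib])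
  | mul_X p i hp =>
    have h1 : HasFDerivAt (fun y => φ y i) ((ContinuousLinearMap.proj i).comp φ') x :=
      (ContinuousLinearMap.proj (R := ℂ) (φ := fun _ : ι => ℂ) i).hasFDerivAt.comp x hφ
    have h2 := hp.mul h1
    have h3 : (fun y => eval (φ y) (p * X i)) = (fun y => eval (φ y) p) * fun y => φ y i := by
      ext y; simp
    rw [h3]
    refine h2.congr_fderiv ?_
    ext v
    simp [pderiv_X, Pi.single_apply, add_mul, Finset.sum_add_distrib, Finset.mul_sum,
      mul_assoc, apply_ite]

/-- Pulling back polynomials along a germ of an analytic map. -/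
def pullback (φ : (Fin n → ℂ) → (Fin (n + 1) → ℂ)) (hφ : AnalyticAt ℂ φ 0) :
    MvPolynomial (Fin (n + 1)) ℂ →+* HolGerm n where
  toFun P := HolGerm.of (fun y => eval (φ y) P) (analyticAt_eval hφ P)
  map_one' := by
    simp only [map_one]
    rfl
  map_mul' P Q := by
    simp only [map_mul]
    rfl
  map_zero' := by
    simp only [map_zero]
    rfl
  map_add' P Q := by
    simp only [map_add]
    rfl

variable {φ : (Fin n → ℂ) → (Fin (n + 1) → ℂ)} (hφ : AnalyticAt ℂ φ 0)

theorem value_pullback (P : MvPolynomial (Fin (n + 1)) ℂ) :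
    HolGerm.value n (pullback φ hφ P) = eval (φ 0) P :=
  rfl

theorem analyticAt_fderiv_single {h : (Fin n → ℂ) → ℂ} (hh : AnalyticAt ℂ h 0) (i : Fin n) :
    AnalyticAt ℂ (fun x => fderiv ℂ h x (Pi.single i 1)) 0 :=
  ((ContinuousLinearMap.apply ℂ ℂ (Pi.single i (1 : ℂ) : Fin n → ℂ)).analyticAt _).comp hh.fderiv

theorem partialDeriv_of {h : (Fin n → ℂ) → ℂ} (hh : AnalyticAt ℂ h 0) (i : Fin n) :
    HolGerm.partialDeriv i (HolGerm.of h hh) = HolGerm.of (fun x => fderiv ℂ h x (Pi.single i 1))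
      (analyticAt_fderiv_single hh i) :=
  rfl

theorem partialDeriv_mul (i : Fin n) (u g : HolGerm n) :
    HolGerm.partialDeriv i (u * g) =
      u * HolGerm.partialDeriv i g + g * HolGerm.partialDeriv i u := by
  obtain ⟨h, hh, rfl⟩ := HolGerm.exists_of u
  obtain ⟨k, hk, rfl⟩ := HolGerm.exists_of g
  have h1 : HolGerm.of h hh * HolGerm.of k hk = HolGerm.of (h * k) (hh.mul hk) := rfl
  rw [h1, partialDeriv_of, partialDeriv_of, partialDeriv_of]
  refine HolGerm.of_eq_of (hk := (hh.mul (analyticAt_fderiv_single hk i)).add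
    (hk.mul (analyticAt_fderiv_single hh i))).2 ?_
  filter_upwards [hh.eventually_analyticAt, hk.eventually_analyticAt] with x hx hx'
  rw [fderiv_mul hx.differentiableAt hx'.differentiableAt]
  simp

theorem tjurinaIdeal_mul_le (u g : HolGerm n) :
    HolGerm.jacobianIdeal (u * g) ⊔ Ideal.span {u * g} ≤
      HolGerm.jacobianIdeal g ⊔ Ideal.span {g} := by
  have hg : g ∈ HolGerm.jacobianIdeal g ⊔ Ideal.span {g} :=
    Submodule.mem_sup_right (Ideal.mem_span_singleton_self g)
  refine sup_le (Ideal.span_le.2 ?_) ((Ideal.span_singleton_le_iff_mem _).2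
    (Ideal.mul_mem_left _ _ hg))
  rintro _ ⟨i, rfl⟩
  simp only [partialDeriv_mul]
  exact add_mem (Ideal.mul_mem_left _ _ (Submodule.mem_sup_left (Ideal.subset_span ⟨i, rfl⟩)))
    (Ideal.mul_mem_right _ _ hg)

/-- Including `g` in the ideal absorbs the terms `g * ∂u` of the product rule, so the Tjurina ideal
does not see the unit in a local equation. -/
theorem tjurinaIdeal_units_mul (u : (HolGerm n)ˣ) (g : HolGerm n) :
    HolGerm.jacobianIdeal ((u : HolGerm n) * g) ⊔ Ideal.span {(u : HolGerm n) * g} =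
      HolGerm.jacobianIdeal g ⊔ Ideal.span {g} := by
  refine le_antisymm (tjurinaIdeal_mul_le _ _) ?_
  have h := tjurinaIdeal_mul_le ((u⁻¹ : (HolGerm n)ˣ) : HolGerm n) ((u : HolGerm n) * g)
  rwa [← mul_assoc, Units.inv_mul, one_mul] at h

/-- The matrix whose rows are `φ(0)` and the first partial derivatives of `φ` at the origin. -/
def frame (φ : (Fin n → ℂ) → (Fin (n + 1) → ℂ)) : Matrix (Fin (n + 1)) (Fin (n + 1)) ℂ :=
  Matrix.of (Fin.cons (φ 0) fun i => fderiv ℂ φ 0 (Pi.single i 1))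

theorem isUnit_det_frame
    (hinj : Function.Injective fun cv : ℂ × (Fin n → ℂ) => cv.1 • φ 0 + fderiv ℂ φ 0 cv.2) :
    IsUnit (frame φ).det := by
  rw [← Matrix.isUnit_iff_isUnit_det, ← Matrix.vecMul_injective_iff_isUnit]
  have key : ∀ v : Fin (n + 1) → ℂ, Matrix.vecMul v (frame φ) =
      v 0 • φ 0 + fderiv ℂ φ 0 (Fin.tail v) := by
    intro v
    have h1 : fderiv ℂ φ 0 (Fin.tail v) =
        ∑ i : Fin n, v i.succ • fderiv ℂ φ 0 (Pi.single i 1) := by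
      conv_lhs => rw [pi_eq_sum_univ' (Fin.tail v)]
      simp [Fin.tail]
    rw [h1]
    ext j
    simp [Matrix.vecMul, dotProduct, frame, Fin.sum_univ_succ]
  intro v w hvw
  simp only [key] at hvw
  have h2 := @hinj (v 0, Fin.tail v) (w 0, Fin.tail w) hvw
  rw [Prod.mk.injEq] at h2
  rw [← Fin.cons_self_tail v, ← Fin.cons_self_tail w, h2.1, h2.2]

theorem analyticAt_fderiv_apply (i : Fin n) (j : Fin (n + 1)) (hφ : AnalyticAt ℂ φ 0) :
    AnalyticAt ℂ (fun y => fderiv ℂ φ y (Pi.single i 1) j) 0 :=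
  ((ContinuousLinearMap.proj (R := ℂ) (φ := fun _ : Fin (n + 1) => ℂ) j).analyticAt _).comp
    (((ContinuousLinearMap.apply ℂ (Fin (n + 1) → ℂ)
      (Pi.single i (1 : ℂ) : Fin n → ℂ)).analyticAt _).comp hφ.fderiv)

theorem partialDeriv_pullback (i : Fin n) (P : MvPolynomial (Fin (n + 1)) ℂ) :
    HolGerm.partialDeriv i (pullback φ hφ P) =
      ∑ j, HolGerm.of _ (analyticAt_fderiv_apply i j hφ) * pullback φ hφ (pderiv j P) := by
  have h1 : ∀ j, HolGerm.of _ (analyticAt_fderiv_apply i j hφ) * pullback φ hφ (pderiv j P) =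
      HolGerm.of _ ((analyticAt_fderiv_apply i j hφ).mul (analyticAt_eval hφ (pderiv j P))) :=
    fun j => rfl
  simp_rw [h1]
  rw [HolGerm.coe_sum, show pullback φ hφ P = HolGerm.of _ (analyticAt_eval hφ P) from rfl,
    partialDeriv_of, HolGerm.of_eq_of]
  filter_upwards [hφ.eventually_analyticAt] with y hy
  rw [(hasFDerivAt_eval hy.differentiableAt.hasFDerivAt P).fderiv]
  simp [mul_comm]

/-- The Tjurina ideal in local coordinates is generated by the partial derivatives of a
homogeneous equation. -/
theorem span_pullback_pderiv (hdet : IsUnit (frame φ).det) {f : MvPolynomial (Fin (n + 1)) ℂ}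
    {N : ℕ} (hN : N ≠ 0) (hf : f.IsHomogeneous N) :
    Ideal.span (Set.range fun j => pullback φ hφ (pderiv j f)) =
      HolGerm.jacobianIdeal (pullback φ hφ f) ⊔ Ideal.span {pullback φ hφ f} := by
  -- The rows are `φ` and its partial derivatives. Euler's formula turns row `0` into `N` times the
  -- equation and the chain rule turns the others into its partials; the value of `B` at the origin
  -- is the frame.
  let B : Matrix (Fin (n + 1)) (Fin (n + 1)) (HolGerm n) :=
    Matrix.of (Fin.cons (fun j => pullback φ hφ (X j))
      fun i j => HolGerm.of _ (analyticAt_fderiv_apply i j hφ))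
  have hB : IsUnit B.det := by
    refine HolGerm.isUnit_det_of_value ?_
    have : B.map (HolGerm.value n) = frame φ := by
      ext i j
      refine Fin.cases ?_ (fun i => ?_) i
      · simp [B, frame, value_pullback]
      · simp [B, frame, HolGerm.value_of]
    rw [this]
    exact hdet.ne_zero
  have hNu : IsUnit ((N : ℕ) : HolGerm n) := by
    refine HolGerm.isUnit_of_value_ne_zero ?_
    rw [map_natCast]
    exact_mod_cast hN
  rw [← span_range_mulVec_eq hB]
  have hmul : B.mulVec (fun j => pullback φ hφ (pderiv j f)) =
      Fin.cons ((N : HolGerm n) * pullback φ hφ f)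
        (fun i => HolGerm.partialDeriv i (pullback φ hφ f)) := by
    ext1 i
    refine Fin.cases ?_ (fun i => ?_) i
    · rw [Fin.cons_zero, ← map_natCast (pullback φ hφ), ← map_mul, ← nsmul_eq_mul,
        ← hf.sum_X_mul_pderiv, map_sum]
      simp [B, Matrix.mulVec, dotProduct]
    · rw [Fin.cons_succ, partialDeriv_pullback]
      simp [B, Matrix.mulVec, dotProduct]
  rw [hmul, Fin.range_cons, Ideal.span_insert, Ideal.span_singleton_mul_left_unit hNu, sup_comm]
  rfl

end Pullback

/-! ### Comparison of polynomial and analytic local algebra -/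

theorem eval_smul_of_isHomogeneous {K ι : Type*} [Field K] [Fintype ι] {P : MvPolynomial ι K}
    {D : ℕ} (hP : P.IsHomogeneous D) (c : K) (x : ι → K) :
    eval (c • x) P = c ^ D * eval x P := by
  rw [eval_eq', eval_eq', Finset.mul_sum]
  refine Finset.sum_congr rfl fun α hα => ?_
  have h1 : ∑ i, α i = D := by
    have := hP (mem_support_iff.1 hα)
    rwa [← Finsupp.degree_eq_sum, Finsupp.degree_eq_weight_one]
  simp only [Pi.smul_apply, smul_eq_mul, mul_pow, Finset.prod_mul_distrib,
    Finset.prod_pow_eq_pow_sum, h1]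
  ring

section Local

variable {n : ℕ}

/-- The homogeneous coordinates dual to the frame of a parametrization. -/
def coordForm (φ : (Fin n → ℂ) → (Fin (n + 1) → ℂ)) (i : Fin (n + 1)) :
    MvPolynomial (Fin (n + 1)) ℂ :=
  linearForm fun j => (frame φ)⁻¹ j i

/-- The homogeneous ideal of the point parametrized by `φ(0)`. -/
def coordIdeal (φ : (Fin n → ℂ) → (Fin (n + 1) → ℂ)) : Ideal (MvPolynomial (Fin (n + 1)) ℂ) :=
  Ideal.span (Set.range fun i : Fin n => coordForm φ i.succ)

variable {φ : (Fin n → ℂ) → (Fin (n + 1) → ℂ)} (hφ : AnalyticAt ℂ φ 0)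

theorem sum_inv_frame_mul (hdet : IsUnit (frame φ).det) (k i : Fin (n + 1)) :
    ∑ j, (frame φ)⁻¹ j i * frame φ k j = if k = i then 1 else 0 := by
  have := congrFun (congrFun (Matrix.mul_nonsing_inv _ hdet) k) i
  rw [Matrix.mul_apply, Matrix.one_apply] at this
  rw [← this]
  exact Finset.sum_congr rfl fun j _ => mul_comm _ _

theorem eval_coordForm (hdet : IsUnit (frame φ).det) (i : Fin (n + 1)) :
    eval (φ 0) (coordForm φ i) = if 0 = i then 1 else 0 := by
  rw [coordForm, eval_linearForm, ← sum_inv_frame_mul hdet]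
  rfl

theorem fderiv_eval_coordForm (hφ : AnalyticAt ℂ φ 0) (hdet : IsUnit (frame φ).det) (i : Fin n) (v : Fin n → ℂ) :
    fderiv ℂ (fun y => eval (φ y) (coordForm φ i.succ)) 0 v = v i := by
  rw [(hasFDerivAt_eval hφ.differentiableAt.hasFDerivAt _).fderiv]
  have h1 : fderiv ℂ φ 0 v = ∑ k : Fin n, v k • fderiv ℂ φ 0 (Pi.single k 1) := by
    conv_lhs => rw [pi_eq_sum_univ' v]
    simp
  have h2 : ∀ k : Fin n, ∑ j, (frame φ)⁻¹ j i.succ * fderiv ℂ φ 0 (Pi.single k 1) j =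
      if k = i then 1 else 0 := by
    intro k
    have := sum_inv_frame_mul hdet k.succ i.succ
    simpa [frame] using this
  simp only [coordForm, pderiv_linearForm, eval_C, FunLike.coe_sum, Finset.sum_apply,
    FunLike.coe_smul, Pi.smul_apply, ContinuousLinearMap.comp_apply, ContinuousLinearMap.proj_apply,
    h1, smul_eq_mul, Finset.mul_sum]
  rw [Finset.sum_comm]
  calc ∑ k, ∑ j, (frame φ)⁻¹ j i.succ * (v k * fderiv ℂ φ 0 (Pi.single k 1) j)
      = ∑ k, v k * ∑ j, (frame φ)⁻¹ j i.succ * fderiv ℂ φ 0 (Pi.single k 1) j := by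
        refine Finset.sum_congr rfl fun k _ => ?_
        rw [Finset.mul_sum]
        exact Finset.sum_congr rfl fun j _ => by ring
    _ = v i := by simp [h2]

/-- The forms `coordForm φ i.succ` pull back to the coordinates of `ℂⁿ` up to first order, so the
matrix relating both families has value `1` at the origin and is invertible. -/
theorem maxIdeal_eq_map_coordIdeal (hdet : IsUnit (frame φ).det) :
    HolGerm.maxIdeal n = (coordIdeal φ).map (pullback φ hφ) := by
  have h0 : ∀ i : Fin n, eval (φ 0) (coordForm φ i.succ) = 0 := fun i => by
    rw [eval_coordForm hdet, if_neg (Fin.succ_ne_zero i).symm]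
  choose G hG hG' using fun i : Fin n =>
    HolGerm.exists_eq_sum_coord (analyticAt_eval hφ (coordForm φ i.succ)) (h0 i)
  let B : Matrix (Fin n) (Fin n) (HolGerm n) := Matrix.of G
  have hB : IsUnit B.det := by
    refine HolGerm.isUnit_det_of_value ?_
    have : B.map (HolGerm.value n) = 1 := by
      ext i k
      rw [Matrix.map_apply, show B i k = G i k from rfl, hG', fderiv_eval_coordForm hφ hdet, Matrix.one_apply,
        Pi.single_apply]
    rw [this, Matrix.det_one]
    exact one_ne_zero
  rw [HolGerm.maxIdeal_eq_span_coord, coordIdeal, Ideal.map_span, ← Set.range_comp,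
    ← span_range_mulVec_eq hB]
  congr 2
  ext1 i
  exact (hG i).symm

/-- Modulo any power of the maximal ideal, holomorphic germs are pulled back from forms of any
large degree. -/
theorem exists_isHomogeneous_sub_pullback_mem (hdet : IsUnit (frame φ).det) (A : ℕ) :
    ∀ D, A ≤ D → ∀ r : HolGerm n, ∃ P : MvPolynomial (Fin (n + 1)) ℂ, P.IsHomogeneous D ∧
      r - pullback φ hφ P ∈ HolGerm.maxIdeal n ^ A := by
  induction A with
  | zero => exact fun D _ r => ⟨0, isHomogeneous_zero _ _ _, by simp⟩
  | succ A ih =>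
    intro D hD r
    -- Since `coordForm φ 0` is `1` at `φ 0`, its powers adjust the degree without changing the
    -- value there.
    have h1 : r - pullback φ hφ (C (HolGerm.value n r) * coordForm φ 0 ^ D) ∈
        HolGerm.maxIdeal n := by
      rw [HolGerm.mem_maxIdeal, map_sub, value_pullback, map_mul, map_pow, eval_coordForm hdet]
      simp
    have hspan := maxIdeal_eq_map_coordIdeal hφ hdet
    rw [coordIdeal, Ideal.map_span, ← Set.range_comp] at hspan
    have h2 := h1
    rw [hspan] at h2
    obtain ⟨c, hc⟩ := (Submodule.mem_span_range_iff_exists_fun _).1 h2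
    choose P hP hcP using fun i => ih (D - 1) (by omega) (c i)
    refine ⟨C (HolGerm.value n r) * coordForm φ 0 ^ D + ∑ i, P i * coordForm φ i.succ, ?_, ?_⟩
    · refine IsHomogeneous.add ?_ (IsHomogeneous.sum _ _ _ fun i _ => ?_)
      · have := ((isHomogeneous_linearForm fun j => (frame φ)⁻¹ j 0).pow D).C_mul
          (HolGerm.value n r)
        rwa [one_mul] at this
      · have := (hP i).mul (isHomogeneous_linearForm fun j => (frame φ)⁻¹ j i.succ)
        rwa [Nat.sub_add_cancel (by omega)] at this
    · have h3 : r - pullback φ hφ (C (HolGerm.value n r) * coordForm φ 0 ^ D +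
          ∑ i, P i * coordForm φ i.succ) =
          ∑ i, (c i - pullback φ hφ (P i)) * pullback φ hφ (coordForm φ i.succ) := by
        rw [map_add, ← sub_sub, ← hc, map_sum, ← Finset.sum_sub_distrib]
        refine Finset.sum_congr rfl fun i _ => ?_
        rw [map_mul, smul_eq_mul, Function.comp, sub_mul]
      rw [h3, pow_succ]
      refine Ideal.sum_mem _ fun i _ => Ideal.mul_mem_mul (hcP i) ?_
      rw [hspan]
      exact Ideal.subset_span ⟨i, rfl⟩

theorem aeval_coordForm_linearForm (hdet : IsUnit (frame φ).det) (j : Fin (n + 1)) :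
    aeval (coordForm φ) (linearForm fun i => frame φ i j) =
      (X j : MvPolynomial (Fin (n + 1)) ℂ) := by
  have h1 : ∀ k, ∑ i, (frame φ)⁻¹ k i * frame φ i j = if k = j then 1 else 0 := fun k => by
    have := congrFun (congrFun (Matrix.nonsing_inv_mul _ hdet) k) j
    rwa [Matrix.mul_apply, Matrix.one_apply] at this
  simp only [linearForm, map_sum, map_mul, aeval_X, coordForm, algHom_C,
    MvPolynomial.algebraMap_eq, Finset.mul_sum]
  rw [Finset.sum_comm]
  calc ∑ k, ∑ i, (C (frame φ i j) * (C ((frame φ)⁻¹ k i) * X k) : MvPolynomial (Fin (n + 1)) ℂ)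
      = ∑ k, C (∑ i, (frame φ)⁻¹ k i * frame φ i j) * X k := by
        refine Finset.sum_congr rfl fun k _ => ?_
        rw [map_sum, Finset.sum_mul]
        exact Finset.sum_congr rfl fun i _ => by rw [map_mul]; ring
    _ = X j := by simp [h1]

/-- A form whose pullback vanishes to order `A` lies in the `A`-th power of the ideal of the
point. -/
theorem mem_coordIdeal_pow_of_pullback_mem (hdet : IsUnit (frame φ).det) {D A : ℕ}
    {Q : MvPolynomial (Fin (n + 1)) ℂ} (hQ : Q.IsHomogeneous D)
    (hmem : pullback φ hφ Q ∈ HolGerm.maxIdeal n ^ A) : Q ∈ coordIdeal φ ^ A := by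
  classical
  let Q' : MvPolynomial (Fin (n + 1)) ℂ := aeval (fun j => linearForm fun i => frame φ i j) Q
  have hQ' : Q'.IsHomogeneous D := by
    have := hQ.aeval (fun j => linearForm fun i => frame φ i j) fun j => isHomogeneous_linearForm _
    rwa [one_mul] at this
  have hQQ' : aeval (coordForm φ) Q' = Q := by
    have h1 : (aeval (coordForm φ)).comp (aeval fun j => linearForm fun i => frame φ i j) =
        AlgHom.id ℂ (MvPolynomial (Fin (n + 1)) ℂ) := by
      ext1 j
      rw [AlgHom.comp_apply, aeval_X, aeval_coordForm_linearForm hdet, AlgHom.id_apply]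
    exact DFunLike.congr_fun h1 Q
  -- In the coordinates dual to the frame, the order at the point is the degree in all variables
  -- except the first.
  let wt : (Fin (n + 1) →₀ ℕ) → ℕ := fun α => ∑ i : Fin n, α i.succ
  have hwt : ∀ α ∈ Q'.support, A ≤ wt α := by
    by_contra! hcon
    obtain ⟨α₁, hα₁, hα₁A⟩ := hcon
    obtain ⟨α₀, hα₀, hmin⟩ := Finset.exists_min_image Q'.support wt ⟨α₁, hα₁⟩
    set k := wt α₀ with hk
    have hkA : k < A := (hmin α₁ hα₁).trans_lt hα₁A
    let W : MvPolynomial (Fin (n + 1)) ℂ :=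
      ∑ α ∈ Q'.support with wt α = k, monomial α (coeff α Q')
    have hW0 : W ≠ 0 := by
      intro h
      have h1 : coeff α₀ W = coeff α₀ Q' := by
        simp only [W, coeff_sum, coeff_monomial, Finset.sum_ite_eq', Finset.mem_filter]
        rw [if_pos ⟨hα₀, rfl⟩]
      rw [h, coeff_zero] at h1
      exact mem_support_iff.1 hα₀ h1.symm
    have hWhom : W.IsHomogeneous D :=
      IsHomogeneous.sum _ _ _ fun α hα => isHomogeneous_monomial _
        (by
          have := hQ' (mem_support_iff.1 (Finset.mem_filter.1 hα).1)
          rwa [Finsupp.degree_eq_weight_one])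
    -- Along `t ↦ φ (t • v)`, `Q` equals `t ^ k * H t` with `H 0` the value of the lowest part `W`
    -- at `(1, v)`. Vanishing to order `A > k` forces `H 0 = 0`.
    have hW1 : ∀ v : Fin n → ℂ, eval (Fin.cons 1 v : Fin (n + 1) → ℂ) W = 0 := by
      intro v
      let l : Fin (n + 1) → ℂ → ℂ := fun i t => eval (φ (t • v)) (coordForm φ i)
      have hld : ∀ i, HasFDerivAt (fun y => eval (φ y) (coordForm φ i))
          (fderiv ℂ (fun y => eval (φ y) (coordForm φ i)) 0) ((0 : ℂ) • v) := by
        intro i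
        rw [zero_smul]
        exact (analyticAt_eval hφ _).differentiableAt.hasFDerivAt
      have hl : ∀ i, HasDerivAt (l i) (fderiv ℂ (fun y => eval (φ y) (coordForm φ i)) 0 v) 0 := by
        intro i
        have h1 : HasDerivAt (fun t : ℂ => t • v) v 0 := by
          simpa using (hasDerivAt_id (0 : ℂ)).smul_const v
        exact (hld i).comp_hasDerivAt 0 h1
      have hl0 : ∀ i, l i 0 = if 0 = i then 1 else 0 := fun i => by
        simp only [l, zero_smul]
        exact eval_coordForm hdet i
      let b : ℂ → Fin (n + 1) → ℂ := fun t => Fin.cons (l 0 t) fun i => dslope (l i.succ) 0 t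
      have hb0 : b 0 = Fin.cons 1 v := by
        simp only [b]
        rw [hl0, if_pos rfl]
        congr 1
        ext i
        rw [dslope_same, (hl i.succ).deriv, fderiv_eval_coordForm hφ hdet]
      have hbc : ∀ i, ContinuousAt (fun t => b t i) 0 := by
        intro i
        refine Fin.cases ?_ (fun i => ?_) i
        · exact (hl 0).continuousAt
        · exact continuousAt_dslope_same.2 (hl i.succ).differentiableAt
      let H : ℂ → ℂ := fun t => ∑ α ∈ Q'.support, coeff α Q' * (t ^ (wt α - k) * ∏ i, b t i ^ α i)
      have hHc : ContinuousAt H 0 := by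
        refine tendsto_finsetSum _ fun α _ => ?_
        refine (continuousAt_const (y := coeff α Q')).mul (((continuousAt_id).pow _).mul ?_)
        exact tendsto_finsetProd _ fun i _ => (hbc i).pow _
      have hH0 : H 0 = eval (Fin.cons 1 v : Fin (n + 1) → ℂ) W := by
        simp only [H, W, map_sum, eval_monomial, hb0]
        rw [Finset.sum_filter]
        refine Finset.sum_congr rfl fun α hα => ?_
        have := hmin α hα
        split_ifs with h
        · rw [h, Nat.sub_self, pow_zero, one_mul, Finsupp.prod_fintype _ _ (by simp)]
        · rw [zero_pow (by omega)]; simp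
      have hF : ∀ t, eval (φ (t • v)) Q = t ^ k * H t := by
        intro t
        have h1 : eval (φ (t • v)) Q = eval (fun i => l i t) Q' := by
          conv_lhs => rw [← hQQ']
          rw [← aeval_eq_eval, ← aeval_eq_eval, ← AlgHom.comp_apply, comp_aeval]
          rfl
        have h2 : ∀ i : Fin n, l i.succ t = t * b t i.succ := by
          intro i
          have := sub_smul_dslope (l i.succ) 0 t
          rw [hl0, if_neg (Fin.succ_ne_zero i).symm, sub_zero, sub_zero, smul_eq_mul] at this
          exact this.symm
        rw [h1, eval_eq']
        simp only [H, Finset.mul_sum]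
        refine Finset.sum_congr rfl fun α hα => ?_
        have h3 : ∏ i, l i t ^ α i = t ^ wt α * ∏ i, b t i ^ α i := by
          rw [Fin.prod_univ_succ, Fin.prod_univ_succ]
          simp only [h2, mul_pow, Finset.prod_mul_distrib, Finset.prod_pow_eq_pow_sum]
          simp only [b, Fin.cons_zero, wt]
          ring
        have h4 : t ^ wt α = t ^ k * t ^ (wt α - k) := by
          rw [← pow_add, Nat.add_sub_cancel' (hmin α hα)]
        rw [h3, h4]
        ring
      obtain ⟨h, hh, hhe, hO⟩ := HolGerm.isBigO_of_mem_maxIdeal_pow A hmem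
      have hQO : (fun y => eval (φ y) Q) =O[𝓝 0] fun y : Fin n → ℂ => ‖y‖ ^ A :=
        (HolGerm.of_eq_of (hh := analyticAt_eval hφ Q).1 hhe).trans_isBigO hO
      have htv : Tendsto (fun t : ℂ => t • v) (𝓝 0) (𝓝 0) := by
        have : Continuous fun t : ℂ => t • v := by fun_prop
        simpa using this.tendsto 0
      have hFO : (fun t : ℂ => t ^ k * H t) =O[𝓝 0] fun t : ℂ => t ^ A := by
        have h1 := hQO.comp_tendsto htv
        simp only [Function.comp_def, hF] at h1
        refine h1.trans ?_
        simp only [norm_smul, mul_pow]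
        refine Asymptotics.IsBigO.of_bound (‖v‖ ^ A) (Eventually.of_forall fun t => ?_)
        rw [norm_mul, norm_pow, norm_pow, norm_pow, norm_norm, norm_norm, mul_comm]
      have hHO : H =O[𝓝[≠] 0] fun t : ℂ => t ^ (A - k) := by
        have h1 := (hFO.mono nhdsWithin_le_nhds :
          (fun t : ℂ => t ^ k * H t) =O[𝓝[≠] 0] fun t : ℂ => t ^ A)
        have h2 := (Asymptotics.isBigO_refl (fun t : ℂ => (t ^ k)⁻¹) (𝓝[≠] 0)).mul h1
        refine (h2.congr' ?_ ?_)
        · filter_upwards [self_mem_nhdsWithin] with t ht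
          have ht' : t ≠ 0 := ht
          field_simp
        · filter_upwards [self_mem_nhdsWithin] with t ht
          have ht' : t ≠ 0 := ht
          have : t ^ A = t ^ k * t ^ (A - k) := by
            rw [← pow_add, Nat.add_sub_cancel' hkA.le]
          rw [this, inv_mul_cancel_left₀ (pow_ne_zero _ ht')]
      have hlim : Tendsto H (𝓝[≠] 0) (𝓝 0) := by
        refine hHO.trans_tendsto ?_
        have : Tendsto (fun t : ℂ => t ^ (A - k)) (𝓝 0) (𝓝 0) := by
          have h1 := ((continuous_pow (M := ℂ) (A - k)).tendsto 0)
          rwa [zero_pow (by omega)] at h1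
        exact this.mono_left nhdsWithin_le_nhds
      rw [← hH0]
      exact tendsto_nhds_unique (hHc.tendsto.mono_left nhdsWithin_le_nhds) hlim
    -- Homogeneity spreads the vanishing of `W` to all points with `x 0 ≠ 0`; the factor `X 0`
    -- covers the rest.
    have hXW : X 0 * W = 0 := by
      refine MvPolynomial.funext fun x => ?_
      rw [map_mul, eval_X, map_zero]
      by_cases hx : x 0 = 0
      · rw [hx, zero_mul]
      · have h1 : x = x 0 • (Fin.cons 1 fun i : Fin n => (x 0)⁻¹ * x i.succ : Fin (n + 1) → ℂ) := by
          ext i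
          refine Fin.cases ?_ (fun i => ?_) i
          · simp
          · simp [mul_inv_cancel_left₀ hx]
        have h2 : eval x W = 0 := by
          rw [h1, eval_smul_of_isHomogeneous hWhom, hW1, mul_zero]
        rw [h2, mul_zero]
    exact hW0 ((mul_eq_zero.1 hXW).resolve_left (X_ne_zero 0))
  rw [← hQQ', aeval_def, eval₂_eq']
  refine Ideal.sum_mem _ fun α hα => Ideal.mul_mem_left _ _ ?_
  rw [Fin.prod_univ_succ]
  refine Ideal.mul_mem_left _ _ (Ideal.pow_le_pow_right (hwt α hα) ?_)
  have h1 : ∏ i : Fin n, coordForm φ i.succ ^ α i.succ ∈ ∏ i : Fin n, coordIdeal φ ^ α i.succ :=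
    Ideal.prod_mem_prod fun i _ => Ideal.pow_mem_pow (Ideal.subset_span (Set.mem_range_self i)) _
  rwa [Finset.prod_pow_eq_pow_sum] at h1

end Local

/-! ### Tjurina orders and the Jacobian ideal -/

section Descent

variable {n : ℕ} {φ : (Fin n → ℂ) → (Fin (n + 1) → ℂ)} (hφ : AnalyticAt ℂ φ 0)

/-- Powers of an ideal generated by linear forms are generated by forms of the right degree. -/
theorem span_pow_le_span_isHomogeneous {ι K : Type*} [Field K] {s : Set (MvPolynomial ι K)}
    (hs : ∀ l ∈ s, l.IsHomogeneous 1) (a : ℕ) :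
    Ideal.span s ^ a ≤ Ideal.span {P | P.IsHomogeneous a ∧ P ∈ Ideal.span s ^ a} := by
  induction a with
  | zero =>
    rw [pow_zero, Ideal.one_eq_top, top_le_iff, Ideal.eq_top_iff_one]
    exact Ideal.subset_span ⟨isHomogeneous_one _ _, Submodule.mem_top⟩
  | succ a ih =>
    calc Ideal.span s ^ (a + 1) = Ideal.span s ^ a * Ideal.span s := pow_succ _ _
      _ ≤ Ideal.span {P | P.IsHomogeneous a ∧ P ∈ Ideal.span s ^ a} * Ideal.span s :=
        Ideal.mul_mono_left ih
      _ ≤ _ := by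
        rw [Ideal.span_mul_span', Ideal.span_le]
        rintro _ ⟨P, hP, l, hl, rfl⟩
        refine Ideal.subset_span ⟨hP.1.mul (hs l hl), ?_⟩
        rw [pow_succ]
        exact Ideal.mul_mem_mul hP.2 (Ideal.subset_span hl)

/-- If the `A`-th power of the ideal of a point lies locally in `J`, and the `a`-th power of the
maximal ideal of the ring of germs lies in the ideal generated by `J`, then so does locally the
`a`-th power of the ideal of the point. -/
theorem mul_mem_of_pullback_le (hdet : IsUnit (frame φ).det)
    {h : Fin (n + 1) → MvPolynomial (Fin (n + 1)) ℂ} {d : ℕ} (hh : ∀ j, (h j).IsHomogeneous d)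
    {s : MvPolynomial (Fin (n + 1)) ℂ} {A a : ℕ}
    (hs : ∀ P ∈ coordIdeal φ ^ A, s * P ∈ Ideal.span (Set.range h))
    (ha : HolGerm.maxIdeal n ^ a ≤ (Ideal.span (Set.range h)).map (pullback φ hφ)) :
    ∀ P ∈ coordIdeal φ ^ a, s * coordForm φ 0 ^ (d + A) * P ∈ Ideal.span (Set.range h) := by
  have key : ∀ P, P.IsHomogeneous a → P ∈ coordIdeal φ ^ a →
      s * coordForm φ 0 ^ (d + A) * P ∈ Ideal.span (Set.range h) := by
    intro P hP hPa
    have h1 : pullback φ hφ P ∈ (Ideal.span (Set.range h)).map (pullback φ hφ) := by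
      apply ha
      rw [maxIdeal_eq_map_coordIdeal hφ hdet, ← Ideal.map_pow]
      exact Ideal.mem_map_of_mem _ hPa
    rw [Ideal.map_span, ← Set.range_comp] at h1
    obtain ⟨c, hc⟩ := (Submodule.mem_span_range_iff_exists_fun _).1 h1
    -- The analytic coefficients are replaced by forms of degree `a + A`, making `Q j * h j` match
    -- the degree of `coordForm φ 0 ^ (d + A) * P`. The error vanishes to order `A`, and `s` carries
    -- it into the ideal.
    choose Q hQ hcQ using fun j => exists_isHomogeneous_sub_pullback_mem hφ hdet A (a + A)
      (by omega) (pullback φ hφ (coordForm φ 0 ^ (d + A)) * c j)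
    have hsum : ∑ j, Q j * h j ∈ Ideal.span (Set.range h) :=
      Ideal.sum_mem _ fun j _ => Ideal.mul_mem_left _ _ (Ideal.subset_span ⟨j, rfl⟩)
    have h2 : coordForm φ 0 ^ (d + A) * P - ∑ j, Q j * h j ∈ coordIdeal φ ^ A := by
      refine mem_coordIdeal_pow_of_pullback_mem hφ hdet (D := d + A + a) ?_ ?_
      · refine IsHomogeneous.sub ?_ (IsHomogeneous.sum _ _ _ fun j _ => ?_)
        · have := ((isHomogeneous_linearForm fun j => (frame φ)⁻¹ j 0).pow (d + A)).mul hP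
          rwa [one_mul] at this
        · have := (hQ j).mul (hh j)
          rwa [show a + A + d = d + A + a by ring] at this
      · have h3 : pullback φ hφ (coordForm φ 0 ^ (d + A) * P - ∑ j, Q j * h j) =
            ∑ j, (pullback φ hφ (coordForm φ 0 ^ (d + A)) * c j - pullback φ hφ (Q j)) *
              pullback φ hφ (h j) := by
          rw [map_sub, map_mul, ← hc, map_sum, Finset.mul_sum, ← Finset.sum_sub_distrib]
          refine Finset.sum_congr rfl fun j _ => ?_
          rw [map_mul, smul_eq_mul, Function.comp]
          ring
        rw [h3]
        exact Ideal.sum_mem _ fun j _ => Ideal.mul_mem_right _ _ (hcQ j)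
    have h4 := hs _ h2
    have h5 : s * coordForm φ 0 ^ (d + A) * P =
        s * (coordForm φ 0 ^ (d + A) * P - ∑ j, Q j * h j) + s * ∑ j, Q j * h j := by ring
    rw [h5]
    exact add_mem h4 (Ideal.mul_mem_left _ _ hsum)
  have hle : coordIdeal φ ^ a ≤ Submodule.comap (R := MvPolynomial (Fin (n + 1)) ℂ)
      (LinearMap.lsmul _ (MvPolynomial (Fin (n + 1)) ℂ) (s * coordForm φ 0 ^ (d + A)))
      (Ideal.span (Set.range h)) := by
    refine (span_pow_le_span_isHomogeneous ?_ a).trans (Ideal.span_le.2 fun P hP => key P hP.1 hP.2)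
    rintro _ ⟨i, rfl⟩
    exact isHomogeneous_linearForm _
  exact hle

/-- Improves a crude exponent `A` to `tjurinaOrder g`. The crude bound serves twice: it shows that
the set whose infimum defines `tjurinaOrder g` is nonempty, so that the infimum is attained, and it
absorbs the error in approximating germs by forms. -/
theorem mul_mem_jacobianIdeal_of_tjurinaOrder (hdet : IsUnit (frame φ).det)
    {f : MvPolynomial (Fin (n + 1)) ℂ} {N : ℕ} (hN : N ≠ 0) (hf : f.IsHomogeneous N)
    {g : HolGerm n} {u : (HolGerm n)ˣ} (hu : pullback φ hφ f = u * g)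
    {s : MvPolynomial (Fin (n + 1)) ℂ} {k A : ℕ} (hsk : s.IsHomogeneous k) (hs0 : eval (φ 0) s ≠ 0)
    (hs : ∀ P ∈ coordIdeal φ ^ A, s * P ∈ jacobianIdeal f) :
    ∃ t k', t.IsHomogeneous k' ∧ eval (φ 0) t ≠ 0 ∧
      ∀ P ∈ coordIdeal φ ^ tjurinaOrder g, t * P ∈ jacobianIdeal f := by
  have hmap : (jacobianIdeal f).map (pullback φ hφ) =
      HolGerm.jacobianIdeal g ⊔ Ideal.span {g} := by
    rw [← tjurinaIdeal_units_mul u g, ← hu, ← span_pullback_pderiv hφ hdet hN hf, jacobianIdeal,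
      Ideal.map_span, ← Set.range_comp]
    rfl
  have hA : HolGerm.maxIdeal n ^ A ≤ HolGerm.jacobianIdeal g ⊔ Ideal.span {g} := by
    rw [← hmap, maxIdeal_eq_map_coordIdeal hφ hdet, ← Ideal.map_pow, Ideal.map_le_iff_le_comap]
    intro P hP
    have h1 := Ideal.mem_map_of_mem (pullback φ hφ) (hs P hP)
    rw [map_mul] at h1
    exact (Ideal.unit_mul_mem_iff_mem _
      (HolGerm.isUnit_of_value_ne_zero (g := pullback φ hφ s) hs0)).1 h1
  have ha : HolGerm.maxIdeal n ^ tjurinaOrder g ≤ HolGerm.jacobianIdeal g ⊔ Ideal.span {g} :=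
    Nat.sInf_mem (s := {a : ℕ | HolGerm.maxIdeal n ^ a ≤
      HolGerm.jacobianIdeal g ⊔ Ideal.span {g}}) ⟨A, hA⟩
  rw [← hmap] at ha
  refine ⟨s * coordForm φ 0 ^ (N - 1 + A), k + 1 * (N - 1 + A),
    hsk.mul ((isHomogeneous_linearForm _).pow _), ?_,
    mul_mem_of_pullback_le hφ hdet (fun j => hf.pderiv) hs ha⟩
  rw [map_mul, map_pow, eval_coordForm hdet]
  simpa using hs0

end Descent

/-! ### From the local orders to the saturation of the Jacobian ideal -/

section Projective

variable {n : ℕ}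

theorem exists_linearForm_of_dual (d : Module.Dual ℂ (Fin (n + 1) → ℂ)) :
    ∃ c : Fin (n + 1) → ℂ, ∀ z, eval z (linearForm c) = d z := by
  refine ⟨fun j => d (Pi.single j 1), fun z => ?_⟩
  rw [eval_linearForm]
  conv_rhs => rw [pi_eq_sum_univ' z]
  simp [mul_comm]

theorem isHomogeneous_pderiv {f : MvPolynomial (Fin (n + 1)) ℂ} {N : ℕ} (hf : f.IsHomogeneous N)
    (j : Fin (n + 1)) : (pderiv j f).IsHomogeneous (N - 1) :=
  hf.pderiv

theorem mem_zeroLocus_jacobianIdeal {f : MvPolynomial (Fin (n + 1)) ℂ} {z : Fin (n + 1) → ℂ}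
    (hz : z ∈ zeroLocus ℂ (jacobianIdeal f)) (j : Fin (n + 1)) : eval z (pderiv j f) = 0 := by
  rw [← aeval_eq_eval]
  exact hz _ (Ideal.subset_span ⟨j, rfl⟩)

theorem mk_mem_singularLocus {f : MvPolynomial (Fin (n + 1)) ℂ} {N : ℕ} (hN : N ≠ 0)
    (hf : f.IsHomogeneous N) {z : Fin (n + 1) → ℂ} (hz0 : z ≠ 0)
    (hz : z ∈ zeroLocus ℂ (jacobianIdeal f)) :
    Projectivization.mk ℂ z hz0 ∈ singularLocus f := by
  obtain ⟨a, ha⟩ := Projectivization.exists_smul_eq_mk_rep ℂ z hz0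
  have h1 : ∀ j, eval (Projectivization.mk ℂ z hz0).rep (pderiv j f) = 0 := by
    intro j
    rw [← ha, Units.smul_def, eval_smul_of_isHomogeneous (isHomogeneous_pderiv hf j),
      mem_zeroLocus_jacobianIdeal hz, mul_zero]
  refine ⟨?_, h1⟩
  have h2 := congrArg (eval (Projectivization.mk ℂ z hz0).rep) hf.sum_X_mul_pderiv
  rw [map_sum, map_nsmul] at h2
  simp only [map_mul, h1, mul_zero, Finset.sum_const_zero] at h2
  rw [eq_comm, smul_eq_zero] at h2
  exact h2.resolve_left hN

/-- A form vanishing at given points of projective space, but not at another one. -/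
theorem exists_isHomogeneous_eval_ne_zero (V : Finset (ℙ ℂ (Fin (n + 1) → ℂ)))
    {p : ℙ ℂ (Fin (n + 1) → ℂ)} (hp : p ∉ V) :
    ∃ (s : MvPolynomial (Fin (n + 1)) ℂ) (k : ℕ), s.IsHomogeneous k ∧ eval p.rep s ≠ 0 ∧
      ∀ q ∈ V, eval q.rep s = 0 := by
  have h1 : ∀ q ∈ V, ∃ c : Fin (n + 1) → ℂ, eval p.rep (linearForm c) ≠ 0 ∧
      eval q.rep (linearForm c) = 0 := by
    intro q hq
    have h2 : p.rep ∉ Submodule.span ℂ {q.rep} := by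
      intro h
      obtain ⟨a, ha⟩ := Submodule.mem_span_singleton.1 h
      have h3 : p = q := by
        rw [← p.mk_rep, ← q.mk_rep, Projectivization.mk_eq_mk_iff']
        exact ⟨a, ha⟩
      exact hp (h3 ▸ hq)
    obtain ⟨d, hd, hle⟩ := Submodule.exists_le_ker_of_notMem h2
    obtain ⟨c, hc⟩ := exists_linearForm_of_dual d
    refine ⟨c, by rwa [hc], ?_⟩
    rw [hc]
    exact hle (Submodule.mem_span_singleton_self _)
  choose! c hc hc' using h1
  refine ⟨∏ q ∈ V, linearForm (c q), ∑ q ∈ V, 1,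
    IsHomogeneous.prod _ _ _ fun q _ => isHomogeneous_linearForm _, ?_, fun q hq => ?_⟩
  · rw [map_prod]
    exact Finset.prod_ne_zero_iff.2 hc
  · rw [map_prod]
    exact Finset.prod_eq_zero hq (hc' q hq)

/-- Near a singular point, the Jacobian ideal contains the power of the ideal of the point given
by the order of the local equation. -/
theorem exists_pointIdeal {f : MvPolynomial (Fin (n + 1)) ℂ} {N : ℕ} (hN : N ≠ 0)
    (hf : f.IsHomogeneous N) (hsing : (singularLocus f).Finite)
    {p : ℙ ℂ (Fin (n + 1) → ℂ)} {g : HolGerm n}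
    (hg : IsLocalEquation f p g) {c : Fin (n + 1) → ℂ} (hc : eval p.rep (linearForm c) ≠ 0) :
    ∃ I : Ideal (MvPolynomial (Fin (n + 1)) ℂ),
      Ideal.span (Set.range X) ≤ I ⊔ Ideal.span {linearForm c} ∧
      ∃ s k, s.IsHomogeneous k ∧ eval p.rep s ≠ 0 ∧
        ∀ P ∈ I ^ tjurinaOrder g, s * P ∈ jacobianIdeal f := by
  classical
  obtain ⟨φ, hφ, ⟨h0, rfl⟩, hinj, u, hu⟩ := hg
  have hdet := isUnit_det_frame hinj
  have hu' : pullback φ hφ f = u * g := Subtype.ext hu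
  obtain ⟨a, ha⟩ := Projectivization.exists_smul_eq_mk_rep ℂ (φ 0) h0
  set p := Projectivization.mk ℂ (φ 0) h0 with hpdef
  have ha' : (a : ℂ) • φ 0 = p.rep := ha
  have hrep : ∀ {k : ℕ} {P : MvPolynomial (Fin (n + 1)) ℂ}, P.IsHomogeneous k →
      (eval p.rep P ≠ 0 ↔ eval (φ 0) P ≠ 0) := by
    intro k P hP
    rw [← ha', eval_smul_of_isHomogeneous hP, mul_ne_zero_iff]
    exact and_iff_right (pow_ne_zero _ a.ne_zero)
  obtain ⟨s, k, hsk, hsp, hsq⟩ := exists_isHomogeneous_eval_ne_zero (hsing.toFinset.erase p)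
    (Finset.notMem_erase p _)
  -- The form `s` vanishes at the other singular points and the coordinate forms vanish at `p`, so
  -- the products vanish on the whole zero locus of the Jacobian ideal.
  have hrad : Ideal.span {s} * coordIdeal φ ≤ (jacobianIdeal f).radical := by
    rw [coordIdeal, Ideal.span_mul_span', Ideal.span_le]
    rintro _ ⟨x, hx, _, ⟨i, rfl⟩, rfl⟩
    obtain rfl : s = x := (Set.mem_singleton_iff.1 hx).symm
    change s * coordForm φ i.succ ∈ (jacobianIdeal f).radical
    rw [← vanishingIdeal_zeroLocus_eq_radical (K := ℂ)]
    intro z hz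
    rw [aeval_eq_eval, map_mul]
    by_cases hz0 : z = 0
    · rw [hz0, coordForm, eval_linearForm]
      simp
    have hzs := mk_mem_singularLocus hN hf hz0 hz
    by_cases hzp : Projectivization.mk ℂ z hz0 = p
    · obtain ⟨b, hb⟩ := (Projectivization.mk_eq_mk_iff' ℂ _ _ _ _).1 hzp
      have h1 : eval (φ 0) (coordForm φ i.succ) = 0 := by
        rw [eval_coordForm hdet, if_neg (Fin.succ_ne_zero i).symm]
      have h2 : eval (b • φ 0) (coordForm φ i.succ) = b ^ 1 * eval (φ 0) (coordForm φ i.succ) :=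
        eval_smul_of_isHomogeneous (isHomogeneous_linearForm _) b (φ 0)
      rw [← hb, h2, h1, mul_zero, mul_zero]
    · have h1 := hsq _ (Finset.mem_erase.2 ⟨hzp, hsing.mem_toFinset.2 hzs⟩)
      obtain ⟨b, hb⟩ := Projectivization.exists_smul_eq_mk_rep ℂ z hz0
      rw [← hb, Units.smul_def, eval_smul_of_isHomogeneous hsk] at h1
      rw [(mul_eq_zero.1 h1).resolve_left (pow_ne_zero _ b.ne_zero), zero_mul]
  obtain ⟨A, hA⟩ := Ideal.exists_pow_le_of_le_radical_of_fg hrad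
    (IsNoetherian.noetherian _)
  obtain ⟨t, k', htk, ht0, ht⟩ := mul_mem_jacobianIdeal_of_tjurinaOrder hφ hdet hN hf hu'
    (s := s ^ A) (A := A) (hsk.pow A)
    (by rw [map_pow]; exact pow_ne_zero _ ((hrep hsk).1 hsp)) (by
      intro P hP
      apply hA
      rw [mul_pow, Ideal.span_singleton_pow]
      exact Ideal.mul_mem_mul (Ideal.mem_span_singleton_self _) hP)
  refine ⟨coordIdeal φ, ?_, t, k', htk, (hrep htk).2 ht0, ht⟩
  rw [Ideal.span_le]
  rintro _ ⟨j, rfl⟩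
  have hc0 := (hrep (isHomogeneous_linearForm c)).1 hc
  let b : ℂ := φ 0 j * (eval (φ 0) (linearForm c))⁻¹
  have h1 : X j - C b * linearForm c ∈ coordIdeal φ := by
    rw [← pow_one (coordIdeal φ)]
    refine mem_coordIdeal_pow_of_pullback_mem hφ hdet (D := 1)
      ((isHomogeneous_X ℂ j).sub ((isHomogeneous_linearForm c).C_mul b)) ?_
    rw [pow_one, HolGerm.mem_maxIdeal, value_pullback, map_sub, map_mul, eval_X, eval_C]
    simp only [b]
    rw [inv_mul_cancel_right₀ hc0, sub_self]
  have h2 : (X j : MvPolynomial (Fin (n + 1)) ℂ) =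
      (X j - C b * linearForm c) + C b * linearForm c := by ring
  rw [h2]
  exact Submodule.add_mem_sup h1 (Ideal.mul_mem_left _ _ (Ideal.mem_span_singleton_self _))

theorem mul_le_mul_sup {R : Type*} [CommRing R] {A B A' B' L : Ideal R} (hA : A ≤ A' ⊔ L)
    (hB : B ≤ B' ⊔ L) : A * B ≤ A' * B' ⊔ L := by
  rw [Ideal.mul_le]
  intro x hx y hy
  obtain ⟨x', hx', l, hl, rfl⟩ := Submodule.mem_sup.1 (hA hx)
  obtain ⟨y', hy', l', hl', rfl⟩ := Submodule.mem_sup.1 (hB hy)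
  have h : (x' + l) * (y' + l') = x' * y' + ((x' + l) * l' + l * y') := by ring
  rw [h]
  exact Submodule.add_mem_sup (Ideal.mul_mem_mul hx' hy')
    (add_mem (Ideal.mul_mem_left _ _ hl') (Ideal.mul_mem_right _ _ hl))

theorem pow_le_pow_sup {R : Type*} [CommRing R] {A A' L : Ideal R} (hA : A ≤ A' ⊔ L) (k : ℕ) :
    A ^ k ≤ A' ^ k ⊔ L := by
  induction k with
  | zero => rw [pow_zero, pow_zero]; exact le_sup_left
  | succ k ih => rw [pow_succ, pow_succ]; exact mul_le_mul_sup ih hA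

theorem prod_pow_sup_le {R ι : Type*} [CommRing R] (V : Finset ι) (I : ι → Ideal R) (a : ι → ℕ)
    {M L : Ideal R} (hM : ∀ p ∈ V, M ≤ I p ⊔ L) :
    M ^ (∑ p ∈ V, a p) ≤ (∏ p ∈ V, I p ^ a p) ⊔ L := by
  classical
  induction V using Finset.induction_on with
  | empty => rw [Finset.sum_empty, Finset.prod_empty, pow_zero]; exact le_sup_left
  | insert p V hp ih =>
    rw [Finset.sum_insert hp, Finset.prod_insert hp, pow_add]
    exact mul_le_mul_sup (pow_le_pow_sup (hM p (Finset.mem_insert_self _ _)) _)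
      (ih fun q hq => hM q (Finset.mem_insert_of_mem hq))

/-- Modulo a linear form `l` without zeros on the singular locus, all forms of degree the sum of
the local orders lie in the saturation of the Jacobian ideal. -/
theorem exists_saturation {f : MvPolynomial (Fin (n + 1)) ℂ} {N : ℕ} (hN : N ≠ 0)
    (hf : f.IsHomogeneous N) (hsing : (singularLocus f).Finite)
    {g : ℙ ℂ (Fin (n + 1) → ℂ) → HolGerm n}
    (hg : ∀ p ∈ singularLocus f, IsLocalEquation f p (g p)) {c : Fin (n + 1) → ℂ}
    (hc : ∀ p ∈ singularLocus f, eval p.rep (linearForm c) ≠ 0) :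
    ∃ Q : Ideal (MvPolynomial (Fin (n + 1)) ℂ),
      (∀ x ∈ Q, ∃ t : ℕ, linearForm c ^ t * x ∈ jacobianIdeal f) ∧
      Ideal.span (Set.range X) ^ (∑ p ∈ hsing.toFinset, tjurinaOrder (g p)) ≤
        Q ⊔ Ideal.span {linearForm c} := by
  choose! I hI s k hsk hsp hs using fun p hp => exists_pointIdeal hN hf hsing (hg p hp) (hc p hp)
  let Q := ∏ p ∈ hsing.toFinset, I p ^ tjurinaOrder (g p)
  refine ⟨Q, ?_, prod_pow_sup_le _ _ _ fun p hp => hI p (hsing.mem_toFinset.1 hp)⟩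
  -- A nonzero zero of `Z = (J : Q)` would represent a singular point `p`, but `s p ∈ Z` does not
  -- vanish there. Hence some power of the linear form lies in `Z`, with one exponent for all of
  -- `Q`.
  let Z : Ideal (MvPolynomial (Fin (n + 1)) ℂ) := (jacobianIdeal f).colon (Q : Set _)
  have hJZ : jacobianIdeal f ≤ Z := fun x hx => Submodule.mem_colon.2 fun y _ =>
    Ideal.mul_mem_right _ _ hx
  have hsZ : ∀ p ∈ singularLocus f, s p ∈ Z := fun p hp => Submodule.mem_colon.2 fun y hy =>
    hs p hp y (Ideal.le_of_dvd (Finset.dvd_prod_of_mem _ (hsing.mem_toFinset.2 hp)) hy)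
  have hrad : linearForm c ∈ Z.radical := by
    rw [← vanishingIdeal_zeroLocus_eq_radical (K := ℂ)]
    intro z hz
    rw [aeval_eq_eval]
    by_cases hz0 : z = 0
    · rw [hz0, eval_linearForm]
      simp
    exfalso
    have hzp := mk_mem_singularLocus hN hf hz0 (zeroLocus_anti_mono hJZ hz)
    obtain ⟨b, hb⟩ := Projectivization.exists_smul_eq_mk_rep ℂ z hz0
    have h1 := hsp _ hzp
    have h2 : eval z (s (Projectivization.mk ℂ z hz0)) = 0 := by
      rw [← aeval_eq_eval]
      exact hz _ (hsZ _ hzp)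
    rw [← hb, Units.smul_def, eval_smul_of_isHomogeneous (hsk _ hzp), h2, mul_zero] at h1
    exact h1 rfl
  obtain ⟨t, ht⟩ := hrad
  exact fun x hx => ⟨t, Submodule.mem_colon.1 ht x hx⟩

end Projective

/-! ### Adapted generators of the Jacobian ideal -/

/-- If `a i * 1` lay in the ideal of the other members, regularity would put `1` there. -/
theorem StronglyRegular.linearIndependent {K ι R : Type*} [Field K] [CommRing R] [Algebra K R]
    {a : ι → R} (ha : StronglyRegular a) (htop : Ideal.span (Set.range a) ≠ ⊤) :
    LinearIndependent K a := by
  rw [linearIndependent_iff_notMem_span]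
  intro i hi
  have h1 : a i ∈ Ideal.span (a '' (Set.univ \ {i})) := Submodule.span_le_restrictScalars K R _ hi
  have h2 := ha i (Set.univ \ {i}) (by simp) 1 (by rwa [mul_one])
  exact htop ((Ideal.eq_top_iff_one _).2 (Ideal.span_mono (Set.image_subset_range _ _) h2))

theorem span_range_ne_top {K ι κ : Type*} [Field K] {a : κ → MvPolynomial ι K} {e : κ → ℕ}
    (he : ∀ i, e i ≠ 0) (ha : ∀ i, (a i).IsHomogeneous (e i)) :
    Ideal.span (Set.range a) ≠ ⊤ := by
  intro h
  have h1 : Ideal.span (Set.range a) ≤ RingHom.ker (eval (0 : ι → K)) := by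
    rw [Ideal.span_le]
    rintro _ ⟨i, rfl⟩
    rw [SetLike.mem_coe, RingHom.mem_ker, eval_zero, constantCoeff_eq]
    exact (ha i).coeff_eq_zero (by simpa using (he i).symm)
  have h2 := h1 ((Ideal.eq_top_iff_one _).1 h)
  rw [RingHom.mem_ker, map_one] at h2
  exact one_ne_zero h2

/-- Modulo the other variables, the form is a nonzero multiple of `X 0`. -/
theorem isNzdMod_linearForm {K : Type*} [Field K] {n : ℕ} {c : Fin (n + 1) → K} (hc : c 0 ≠ 0) :
    IsNzdMod (Ideal.span ((X : Fin (n + 1) → MvPolynomial (Fin (n + 1)) K) '' {0}ᶜ))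
      (linearForm c) := by
  intro x hx
  refine stronglyRegular_X 0 {0}ᶜ (by simp) x ?_
  rw [linearForm, Fin.sum_univ_succ, add_mul] at hx
  have h1 : (∑ i : Fin n, C (c i.succ) * X i.succ) * x ∈
      Ideal.span ((X : Fin (n + 1) → MvPolynomial (Fin (n + 1)) K) '' {0}ᶜ) :=
    Ideal.mul_mem_right _ _ (Ideal.sum_mem _ fun i _ => Ideal.mul_mem_left _ _
      (Ideal.subset_span ⟨i.succ, Fin.succ_ne_zero i, rfl⟩))
  have h2 := Ideal.mul_mem_left _ (C (c 0)⁻¹) ((Ideal.add_mem_iff_left _ h1).1 hx)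
  rwa [← mul_assoc, ← mul_assoc, ← C_mul, inv_mul_cancel₀ hc, C_1, one_mul] at h2

/-- Linearly independent `n` vectors of `Kⁿ⁺¹` are the last rows of an invertible matrix. -/
theorem exists_isUnit_det_of_linearIndependent {K : Type*} [Field K] {n : ℕ}
    {v : Fin n → Fin (n + 1) → K} (hv : LinearIndependent K v) :
    ∃ A : Matrix (Fin (n + 1)) (Fin (n + 1)) K, IsUnit A.det ∧ ∀ i : Fin n, A i.succ = v i := by
  obtain ⟨x, hx⟩ := exists_linearIndependent_cons_of_lt_finrank hv
    (by rw [Module.finrank_fin_fun]; exact n.lt_succ_self)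
  refine ⟨Matrix.of (Fin.cons x v), ?_, fun i => rfl⟩
  rw [← Matrix.isUnit_iff_isUnit_det, ← Matrix.linearIndependent_rows_iff_isUnit]
  exact hx

/-- A linear form that vanishes neither at a point of a given finite set nor at `(1, 0, …, 0)`. -/
theorem exists_linearForm_eval_ne_zero {n : ℕ} {V : Set (ℙ ℂ (Fin (n + 1) → ℂ))} (hV : V.Finite) :
    ∃ c : Fin (n + 1) → ℂ, c 0 ≠ 0 ∧ ∀ p ∈ V, eval p.rep (linearForm c) ≠ 0 := by
  classical
  have := hV.to_subtype
  let x : Option V → (Fin (n + 1) → ℂ) := fun o => o.elim (Pi.single 0 1) fun p => p.1.rep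
  obtain ⟨d, hd⟩ := Module.exists_dual_forall_apply_ne_zero (K := ℂ) x (by
    rintro (_ | p)
    · simp [x]
    · exact p.1.rep_nonzero)
  obtain ⟨c, hc⟩ := exists_linearForm_of_dual d
  refine ⟨c, ?_, fun p hp => ?_⟩
  · have := hd none
    rw [← hc, eval_linearForm] at this
    simpa [x, Pi.single_apply] using this
  · rw [hc]
    exact hd (some ⟨p, hp⟩)

theorem X_mem_radical {n N : ℕ} {f : MvPolynomial (Fin (n + 1)) ℂ} (hN : N ≠ 0)
    (hf : f.IsHomogeneous N) {c : Fin (n + 1) → ℂ}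
    (hc : ∀ p ∈ singularLocus f, eval p.rep (linearForm c) ≠ 0) (j : Fin (n + 1)) :
    X j ∈ (Ideal.span {linearForm c} ⊔ jacobianIdeal f).radical := by
  rw [← vanishingIdeal_zeroLocus_eq_radical (K := ℂ)]
  intro z hz
  rw [aeval_eq_eval]
  by_contra hz1
  have hz0 : z ≠ 0 := by
    rintro rfl
    simp at hz1
  have h1 : eval z (linearForm c) = 0 := by
    rw [← aeval_eq_eval]
    exact hz _ (Submodule.mem_sup_left (Ideal.mem_span_singleton_self _))
  have h2 := mk_mem_singularLocus hN hf hz0 fun x hx => hz x (Submodule.mem_sup_right hx)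
  obtain ⟨b, hb⟩ := Projectivization.exists_smul_eq_mk_rep ℂ z hz0
  apply hc _ h2
  rw [← hb, Units.smul_def, eval_smul_of_isHomogeneous (isHomogeneous_linearForm c), h1, mul_zero]

theorem jacobianIdeal_eq_sup {n : ℕ} {f : MvPolynomial (Fin (n + 1)) ℂ}
    {A : Matrix (Fin (n + 1)) (Fin (n + 1)) ℂ} (hA : IsUnit A.det)
    {a h : Fin (n + 1) → MvPolynomial (Fin (n + 1)) ℂ}
    (hh : h = (A.map C).mulVec fun j => pderiv j f) (hah : ∀ j ≠ 0, a j = h j) :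
    jacobianIdeal f = Ideal.span (a '' {0}ᶜ) ⊔ Ideal.span {h 0} := by
  have hAC : IsUnit (A.map (C : ℂ →+* MvPolynomial (Fin (n + 1)) ℂ)).det := by
    rw [← RingHom.mapMatrix_apply, ← RingHom.map_det]
    exact hA.map C
  have h1 : a '' {0}ᶜ = h '' {0}ᶜ := Set.image_congr fun j hj => hah j hj
  rw [h1, ← span_range_eq_sup, hh, span_range_mulVec_eq hAC, jacobianIdeal]

/-- After a linear change of the partial derivatives of `f`, all of them but the first one form a
regular sequence, modulo which the first one is a nonzerodivisor in low degrees. -/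
theorem exists_adapted_generators {n N : ℕ} (hN : 2 ≤ N) {f : MvPolynomial (Fin (n + 1)) ℂ}
    (hf : f.IsHomogeneous N) (hsing : (singularLocus f).Finite)
    {g : ℙ ℂ (Fin (n + 1) → ℂ) → HolGerm n}
    (hg : ∀ p ∈ singularLocus f, IsLocalEquation f p (g p)) :
    ∃ (A : Matrix (Fin (n + 1)) (Fin (n + 1)) ℂ) (a h : Fin (n + 1) → MvPolynomial (Fin (n + 1)) ℂ),
      IsUnit A.det ∧ h = (A.map C).mulVec (fun j => pderiv j f) ∧ StronglyRegular a ∧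
      (∀ j ≠ 0, a j = h j) ∧ (∀ j, (h j).IsHomogeneous (N - 1)) ∧
      ∀ q u, q + ∑ p ∈ hsing.toFinset, tjurinaOrder (g p) ≤ n * (N - 2) → u.IsHomogeneous q →
        h 0 * u ∈ Ideal.span (a '' {0}ᶜ) → u ∈ Ideal.span (a '' {0}ᶜ) := by
  classical
  obtain ⟨c, hc0, hc⟩ := exists_linearForm_eval_ne_zero hsing
  obtain ⟨Q, hQ, hQs⟩ := exists_saturation (by lia) hf hsing hg hc
  let D : Fin (n + 1) → MvPolynomial (Fin (n + 1)) ℂ := fun j => pderiv j f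
  have hD : ∀ j, (D j).IsHomogeneous (N - 1) := isHomogeneous_pderiv hf
  have hW : ∀ w ∈ Submodule.span ℂ (Set.range D), w.IsHomogeneous (N - 1) := by
    have : Submodule.span ℂ (Set.range D) ≤ homogeneousSubmodule _ ℂ (N - 1) := by
      rw [Submodule.span_le]
      rintro _ ⟨j, rfl⟩
      exact hD j
    exact fun w hw => this hw
  obtain ⟨a, ha0, haT, -, hreg, hsoc⟩ := exists_stronglyRegular (isHomogeneous_linearForm c)
    (isNzdMod_linearForm hc0) (Submodule.span ℂ (Set.range D)) (d := N - 1) (by lia) hW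
    (fun j => Ideal.radical_mono (sup_le_sup_left (Ideal.span_mono Submodule.subset_span) _)
      (X_mem_radical (by lia) hf hc j)) (Finset.univ.erase 0) (by simp)
  replace haT : ∀ j ≠ 0, a j ∈ Submodule.span ℂ (Set.range D) := fun j hj => haT j (by simpa)
  have hahom : ∀ j, (a j).IsHomogeneous (if j = 0 then 1 else N - 1) := by
    intro j
    split_ifs with hj
    · rw [hj, ha0]
      exact isHomogeneous_linearForm c
    · exact hW _ (haT j hj)
  -- Independence of the chosen combinations makes their coefficient vectors independent, so they
  -- extend to an invertible change of generators; row `0` is an arbitrary completion.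
  have hLI : LinearIndependent ℂ fun i : Fin n => a i.succ :=
    (hreg.linearIndependent (span_range_ne_top (fun j => by split_ifs <;> lia) hahom)).comp
      Fin.succ (Fin.succ_injective n)
  choose v hv using fun i : Fin n =>
    (Submodule.mem_span_range_iff_exists_fun ℂ).1 (haT i.succ (Fin.succ_ne_zero i))
  have hvLI : LinearIndependent ℂ v := by
    apply LinearIndependent.of_comp (Fintype.linearCombination ℂ D)
    convert hLI with i
    exact hv i
  obtain ⟨A, hA, hAv⟩ := exists_isUnit_det_of_linearIndependent hvLI
  let h := (A.map C).mulVec D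
  have hh : ∀ j, h j = ∑ k, C (A j k) * D k := fun j => rfl
  have hah : ∀ j ≠ 0, a j = h j := by
    intro j hj
    obtain ⟨i, rfl⟩ := Fin.exists_succ_eq.2 hj
    rw [hh, hAv, ← hv]
    simp only [smul_eq_C_mul]
  refine ⟨A, a, h, hA, rfl, hreg, hah, fun j => IsHomogeneous.sum _ _ _ fun k _ =>
    (hD k).C_mul _, ?_⟩
  intro q u hqs hu huI
  by_contra hu0
  have key := lt_add_of_mul_mem (isHomogeneousIdeal_span_image hahom {0}ᶜ)
    (isHomogeneous_linearForm c) (ha0 ▸ hreg 0 {0}ᶜ (by simp)) (J := jacobianIdeal f)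
    (ha0 ▸ span_range_eq_sup a 0 ▸ hsoc) hQ hQs q u hu hu0 (by
      intro x hx
      rw [jacobianIdeal_eq_sup hA rfl hah] at hx
      obtain ⟨y, hy, z, hz, rfl⟩ := Submodule.mem_sup.1 hx
      obtain ⟨w, rfl⟩ := Ideal.mem_span_singleton'.1 hz
      rw [add_mul, mul_assoc]
      exact add_mem (Ideal.mul_mem_right _ _ hy) (Ideal.mul_mem_left _ _ huI))
  rw [Finset.card_erase_of_mem (Finset.mem_univ _), Finset.card_univ, Fintype.card_fin,
    Nat.add_sub_cancel, Nat.sub_sub] at key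
  lia

/-! ### The bounds -/

/-- In adapted generators the relation puts `h 0 * r' 0` into the ideal of the regular sequence, and
the degree bound then puts `r' 0` there. So the transformed relation is Koszul, and the change of
generators is undone by a transpose. -/
theorem mem_KR_of_mem_AR {n N : ℕ} (hN : 2 ≤ N) {f : MvPolynomial (Fin (n + 1)) ℂ}
    (hf : f.IsHomogeneous N) (hsing : (singularLocus f).Finite)
    {g : ℙ ℂ (Fin (n + 1) → ℂ) → HolGerm n}
    (hg : ∀ p ∈ singularLocus f, IsLocalEquation f p (g p)) {q : ℕ}
    (hq : q + ∑ p ∈ hsing.toFinset, tjurinaOrder (g p) ≤ n * (N - 2))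
    {r : Fin (n + 1) → MvPolynomial (Fin (n + 1)) ℂ} (hr : r ∈ AR f)
    (hrq : ∀ j, (r j).IsHomogeneous q) : r ∈ KR f := by
  obtain ⟨A, a, h, hA, hh, hreg, hah, -, hann⟩ := exists_adapted_generators hN hf hsing hg
  have himg : ∀ T : Set (Fin (n + 1)), 0 ∉ T → h '' T = a '' T := fun T hT =>
    Set.image_congr fun j hj => (hah j (ne_of_mem_of_not_mem hj hT)).symm
  have hBA : (A⁻¹.map (C : ℂ →+* MvPolynomial (Fin (n + 1)) ℂ)) * A.map C = 1 := by
    rw [← Matrix.map_mul, Matrix.nonsing_inv_mul _ hA]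
    exact Matrix.map_one _ C_0 C_1
  let r' := (A⁻¹.map (C : ℂ →+* MvPolynomial (Fin (n + 1)) ℂ)).transpose.mulVec r
  have hr' : (A.map C).transpose.mulVec r' = r := by
    rw [Matrix.mulVec_mulVec, ← Matrix.transpose_mul, hBA, Matrix.transpose_one, Matrix.one_mulVec]
  have hdot : r' ⬝ᵥ h = 0 := by
    rw [hh, Matrix.dotProduct_mulVec, ← Matrix.mulVec_transpose, hr']
    exact hr
  have hr0 : r' 0 ∈ Ideal.span (a '' {0}ᶜ) := by
    refine hann q _ hq (IsHomogeneous.sum _ _ _ fun j _ => (hrq j).C_mul _) ?_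
    rw [dotProduct, ← Finset.add_sum_erase _ _ (Finset.mem_univ 0)] at hdot
    rw [mul_comm, eq_neg_of_add_eq_zero_left hdot]
    refine neg_mem (Ideal.sum_mem _ fun j hj => Ideal.mul_mem_left _ _ ?_)
    have hj0 := Finset.ne_of_mem_erase hj
    exact Ideal.subset_span ⟨j, hj0, hah j hj0⟩
  have h1 : r' ∈ koszulRelations h := by
    refine mem_koszulRelations_of_apply_mem (j := 0) hdot (fun i hi T h0 hiT => ?_) ?_
    · rw [himg T h0, ← hah i hi]
      exact hreg i T hiT
    · rwa [himg _ (by simp)]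
  rw [hh] at h1
  have h2 := transpose_mulVec_mem_koszulRelations h1
  rw [hr'] at h2
  exact h2

theorem ERdeg_eq_bot {n N : ℕ} (hN : 2 ≤ N) {f : MvPolynomial (Fin (n + 1)) ℂ}
    (hf : f.IsHomogeneous N) (hsing : (singularLocus f).Finite)
    {g : ℙ ℂ (Fin (n + 1) → ℂ) → HolGerm n}
    (hg : ∀ p ∈ singularLocus f, IsLocalEquation f p (g p)) {q : ℕ}
    (hq : q + ∑ p ∈ hsing.toFinset, tjurinaOrder (g p) ≤ n * (N - 2)) : ERdeg f q = ⊥ := by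
  rw [eq_bot_iff]
  rintro _ ⟨r, hr, rfl⟩
  rw [Submodule.mem_bot]
  exact (Submodule.Quotient.mk_eq_zero _).2 (mem_KR_of_mem_AR hN hf hsing hg hq r.2 hr)

theorem le_mdr_add {n N : ℕ} (hN : 2 ≤ N) {f : MvPolynomial (Fin (n + 1)) ℂ}
    (hf : f.IsHomogeneous N) (hsing : (singularLocus f).Finite)
    {g : ℙ ℂ (Fin (n + 1) → ℂ) → HolGerm n}
    (hg : ∀ p ∈ singularLocus f, IsLocalEquation f p (g p)) :
    ((n * (N - 2) + 1 : ℕ) : ℕ∞) ≤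
      mdr f + ((∑ p ∈ hsing.toFinset, tjurinaOrder (g p) : ℕ) : ℕ∞) := by
  rw [← tsub_le_iff_right, mdr]
  refine le_iInf₂ fun q hq => ?_
  rw [tsub_le_iff_right]
  by_contra hlt
  refine hq (ERdeg_eq_bot hN hf hsing hg ?_)
  norm_cast at hlt
  lia

/-- Both Jacobian ideals arise from `n` regular forms of degree `N - 1` by adding one more form of
that degree, regular in the relevant degree. The statement is symmetric, so a smooth comparison
hypersurface is the case of an empty sum. -/
theorem finrank_component_congr {n N : ℕ} (hN : 2 ≤ N) {f f' : MvPolynomial (Fin (n + 1)) ℂ}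
    (hf : f.IsHomogeneous N) (hf' : f'.IsHomogeneous N) (hsing : (singularLocus f).Finite)
    (hsing' : (singularLocus f').Finite) {g g' : ℙ ℂ (Fin (n + 1) → ℂ) → HolGerm n}
    (hg : ∀ p ∈ singularLocus f, IsLocalEquation f p (g p))
    (hg' : ∀ p ∈ singularLocus f', IsLocalEquation f' p (g' p)) {k : ℕ}
    (hk : N - 1 ≤ k → k - (N - 1) + ∑ p ∈ hsing.toFinset, tjurinaOrder (g p) ≤ n * (N - 2))
    (hk' : N - 1 ≤ k → k - (N - 1) + ∑ p ∈ hsing'.toFinset, tjurinaOrder (g' p) ≤ n * (N - 2)) :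
    Module.finrank ℂ (MilnorAlgebra.component f k) =
      Module.finrank ℂ (MilnorAlgebra.component f' k) := by
  obtain ⟨A, a, h, hA, hh, hreg, hah, hhom, hann⟩ := exists_adapted_generators hN hf hsing hg
  obtain ⟨A', a', h', hA', hh', hreg', hah', hhom', hann'⟩ := exists_adapted_generators hN hf' hsing' hg'
  have key : Module.finrank ℂ (idealComponent (jacobianIdeal f) k) =
      Module.finrank ℂ (idealComponent (jacobianIdeal f') k) := by
    rw [jacobianIdeal_eq_sup hA hh hah, jacobianIdeal_eq_sup hA' hh' hah']
    refine finrank_idealComponent_sup_congr (isHomogeneousIdeal_span ?_)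
      (isHomogeneousIdeal_span ?_) (hhom 0) (hhom' 0) (fun k => ?_)
      (fun hNk v hv => hann _ _ (hk hNk) hv) (fun hNk v hv => hann' _ _ (hk' hNk) hv)
    · rintro _ ⟨j, hj, rfl⟩
      exact ⟨_, hah j hj ▸ hhom j⟩
    · rintro _ ⟨j, hj, rfl⟩
      exact ⟨_, hah' j hj ▸ hhom' j⟩
    · classical
      have := hreg.finrank_idealComponent_congr hreg' (d := N - 1) (Finset.univ.erase 0)
        (fun i hi => hah i (Finset.ne_of_mem_erase hi) ▸ hhom i)
        (fun i hi => hah' i (Finset.ne_of_mem_erase hi) ▸ hhom' i) k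
      have hT : ((Finset.univ.erase 0 : Finset (Fin (n + 1))) : Set (Fin (n + 1))) = {0}ᶜ := by
        ext; simp
      rwa [hT] at this
  have h1 := finrank_map_mk_add_finrank_idealComponent (jacobianIdeal f) k
  have h2 := finrank_map_mk_add_finrank_idealComponent (jacobianIdeal f') k
  rw [key, ← h2] at h1
  exact Nat.add_right_cancel h1

theorem le_ct_add {n N : ℕ} (hN : 2 ≤ N) {f fs : MvPolynomial (Fin (n + 1)) ℂ}
    (hf : f.IsHomogeneous N) (hsing : (singularLocus f).Finite)
    {g : ℙ ℂ (Fin (n + 1) → ℂ) → HolGerm n}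
    (hg : ∀ p ∈ singularLocus f, IsLocalEquation f p (g p)) (hfs : fs.IsHomogeneous N)
    (hsmooth : singularLocus fs = ∅) :
    (((n + 1) * (N - 2) + 1 : ℕ) : ℕ∞) ≤
      ct f fs + ((∑ p ∈ hsing.toFinset, tjurinaOrder (g p) : ℕ) : ℕ∞) := by
  have hfin : (singularLocus fs).Finite := hsmooth ▸ Set.finite_empty
  rw [← tsub_le_iff_right, ← ENat.natCast_sub, ct]
  -- Here the truncated difference is `0` and the bound is trivial.
  by_cases hle : (n + 1) * (N - 2) + 1 ≤ ∑ p ∈ hsing.toFinset, tjurinaOrder (g p)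
  · rw [Nat.sub_eq_zero_of_le hle]
    exact zero_le
  refine le_iSup₂ (f := fun (q : ℕ) (_ : ∀ k ≤ q, Module.finrank ℂ (MilnorAlgebra.component f k) =
    Module.finrank ℂ (MilnorAlgebra.component fs k)) => (q : ℕ∞)) _ fun k hk => ?_
  obtain ⟨M, rfl⟩ := Nat.exists_eq_add_of_le' hN
  rw [Nat.add_sub_cancel, Nat.succ_mul] at hk hle
  refine finrank_component_congr hN hf hfs hsing hfin hg (g' := fun _ => 0) (by simp [hsmooth])
    (fun hk' => ?_) (fun hk' => ?_)
  -- From `k ≤ (n+1)(N-2) + 1 - ∑ a(g_p)`, removing the degree `N - 1` of the last generator leaves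
  -- exactly `n(N-2) - ∑ a(g_p)`.
  · rw [Nat.add_sub_cancel]
    lia
  · have hfin0 : hfin.toFinset = ∅ := by simp [hsmooth]
    rw [hfin0, Finset.sum_empty, Nat.add_sub_cancel]
    lia

end JacobianSyzygies

end

theorem corollary2p5 (n N : ℕ) (hN : 2 ≤ N)
    (f : MvPolynomial (Fin (n + 1)) ℂ) (hf : f.IsHomogeneous N) (hf0 : f ≠ 0)
    (hsing : (JacobianSyzygies.singularLocus f).Finite)
    (g : ℙ ℂ (Fin (n + 1) → ℂ) → JacobianSyzygies.HolGerm n)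
    (hg : ∀ p ∈ JacobianSyzygies.singularLocus f, JacobianSyzygies.IsLocalEquation f p (g p))
    (fs : MvPolynomial (Fin (n + 1)) ℂ) (hfs : fs.IsHomogeneous N)
    (hsmooth : JacobianSyzygies.singularLocus fs = ∅) :
    ((n * (N - 2) + 1 : ℕ) : ℕ∞) ≤
        JacobianSyzygies.mdr f + ((∑ p ∈ hsing.toFinset, JacobianSyzygies.tjurinaOrder (g p) : ℕ) : ℕ∞) ∧
      (((n + 1) * (N - 2) + 1 : ℕ) : ℕ∞) ≤
        JacobianSyzygies.ct f fs + ((∑ p ∈ hsing.toFinset, JacobianSyzygies.tjurinaOrder (g p) : ℕ) : ℕ∞) :=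
  ⟨JacobianSyzygies.le_mdr_add hN hf hsing hg,
    JacobianSyzygies.le_ct_add hN hf hsing hg hfs hsmooth⟩
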